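/- An instance of the triangle scheduling problem (TS) consists of $n\ge 1$ integers $p_1\ge p_2\ge\dots\ge p_n>0$. A feasible schedule is a choice of starting times $s_1,\dots,s_n\ge 0$ (real numbers) such that $|s_i-s_j|\ge\min\{p_i,p_j\}$ for all $i\ne j$; its makespan is $\max_j (s_j+p_j)$, and $\mathrm{OPT}$ denotes the minimum makespan of a feasible schedule. The input size $N$ is the total number of bits of the binary representations of $p_1,\dots,p_n$. Theorem. TS admits a quasi-polynomial time approximation scheme. That is, for every $\varepsilon>0$ there are a deterministic algorithm and constants $c,k$ such that, on every instance of TS, of size $N$, the algorithm halts within time $2^{c(\log_2 N+1)^k}$ and outputs a feasible schedule (with integer starting times) of makespan at most $(1+\varepsilon)\,\mathrm{OPT}$. Here time is bit complexity: running time on a random access machine (with addition, truncated subtraction, multiplication and integer division of natural numbers) in which every operation costs one plus the bit lengths of the numbers involved. -/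

import Mathlib

namespace TriangleScheduling

/-! ## The triangle scheduling problem -/

/-- An instance: positive integers `p 0 ≥ p 1 ≥ ... ≥ p (n - 1) > 0`. -/
structure Inst where
  n : ℕ
  p : Fin n → ℕ
  sorted : Antitone p
  pos : ∀ i, 0 < p i

/-- The input size: the total length of the binary representations of the `p i`
(so it is at least the number `n` of jobs). -/
def Inst.size (I : Inst) : ℕ := ∑ i, (I.p i).size

/-- Feasible schedules, given by their starting times. -/
def Inst.Feasible (I : Inst) (s : Fin I.n → ℝ) : Prop :=
  (∀ i, 0 ≤ s i) ∧ ∀ i j, i ≠ j → min (I.p i : ℝ) (I.p j : ℝ) ≤ |s i - s j|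

/-- The makespan `max_j (s j + p j)` of a schedule (`0` if there are no jobs). -/
noncomputable def Inst.makespan (I : Inst) (s : Fin I.n → ℝ) : ℝ :=
  ⨆ j, (s j + (I.p j : ℝ))

/-- The optimal makespan over all feasible schedules. -/
noncomputable def Inst.opt (I : Inst) : ℝ :=
  sInf {M | ∃ s, I.Feasible s ∧ I.makespan s = M}

/-- Feasible schedules exist: start job `i` at time `i * ∑ k, p k`. -/
theorem Inst.exists_feasible (I : Inst) : ∃ s, I.Feasible s := by
  refine ⟨fun i => (∑ k, (I.p k : ℝ)) * (i : ℕ), fun i => by positivity, fun i j hij => ?_⟩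
  have hi : (I.p i : ℝ) ≤ ∑ k, (I.p k : ℝ) :=
    Finset.single_le_sum (f := fun k => (I.p k : ℝ)) (fun _ _ => by positivity)
      (Finset.mem_univ i)
  have h0 : (0 : ℝ) ≤ ∑ k, (I.p k : ℝ) := by positivity
  have hne : ((i : ℕ) : ℤ) - ((j : ℕ) : ℤ) ≠ 0 := by
    intro h
    exact hij (Fin.ext (by omega))
  have h1 : (1 : ℝ) ≤ |((i : ℕ) : ℝ) - ((j : ℕ) : ℝ)| := by
    have := Int.one_le_abs hne
    exact_mod_cast this
  rw [← mul_sub, abs_mul, abs_of_nonneg h0]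
  calc min (I.p i : ℝ) (I.p j : ℝ) ≤ I.p i := min_le_left _ _
    _ ≤ ∑ k, (I.p k : ℝ) := hi
    _ ≤ _ := le_mul_of_one_le_right h0 h1

theorem Inst.makespan_nonneg (I : Inst) {s : Fin I.n → ℝ} (hs : I.Feasible s) :
    0 ≤ I.makespan s :=
  Real.iSup_nonneg fun j => add_nonneg (hs.1 j) (Nat.cast_nonneg _)

/-- `opt` is a genuine infimum: the set of makespans is nonempty and bounded below. -/
theorem Inst.isGLB_opt (I : Inst) :
    IsGLB {M | ∃ s, I.Feasible s ∧ I.makespan s = M} I.opt := by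
  obtain ⟨s, hs⟩ := I.exists_feasible
  refine Real.isGLB_sInf ⟨_, s, hs, rfl⟩ ⟨0, ?_⟩
  rintro _ ⟨s, hs, rfl⟩
  exact I.makespan_nonneg hs

/-! ## The machine model

A random access machine over the natural numbers in structured form: registers `reg 0, reg 1, ...`
and arrays `arr 0, arr 1, ...` of unbounded length (a program names only finitely many registers
and arrays). Time is counted under the logarithmic cost criterion: every operation costs one plus
the bit lengths of all numbers involved, so that running times agree, up to a polynomial, with those
of Turing machines. -/

structure State where
  reg : ℕ → ℕ
  arr : ℕ → ℕ → ℕ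

/-- Arithmetic expressions. Subtraction is truncated, division rounds down (and `x / 0 = 0`). -/
inductive AExp where
  | const (k : ℕ)
  | reg (x : ℕ)
  | load (a : ℕ) (i : AExp)
  | add (e f : AExp)
  | sub (e f : AExp)
  | mul (e f : AExp)
  | div (e f : AExp)

/-- The value of an expression. -/
def AExp.val (σ : State) : AExp → ℕ
  | const k => k
  | reg x => σ.reg x
  | load a i => σ.arr a (i.val σ)
  | add e f => e.val σ + f.val σ
  | sub e f => e.val σ - f.val σ
  | mul e f => e.val σ * f.val σ
  | div e f => e.val σ / f.val σ

/-- The cost of evaluating an expression: one plus the bit length of the value, for every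
subexpression (in particular, an array access also pays for the bits of the index). -/
def AExp.cost (σ : State) : AExp → ℕ
  | const k => 1 + k.size
  | reg x => 1 + (σ.reg x).size
  | load a i => i.cost σ + (1 + (σ.arr a (i.val σ)).size)
  | add e f => e.cost σ + f.cost σ + (1 + (e.val σ + f.val σ).size)
  | sub e f => e.cost σ + f.cost σ + (1 + (e.val σ - f.val σ).size)
  | mul e f => e.cost σ + f.cost σ + (1 + (e.val σ * f.val σ).size)
  | div e f => e.cost σ + f.cost σ + (1 + (e.val σ / f.val σ).size)

/-- Programs. A test `e` counts as true if its value is nonzero. -/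
inductive Prog where
  | skip
  | assign (x : ℕ) (e : AExp)
  | store (a : ℕ) (i e : AExp)
  | seq (P Q : Prog)
  | ite (e : AExp) (P Q : Prog)
  | loop (e : AExp) (P : Prog)

/-- The state after `reg x := v`. -/
def State.setReg (σ : State) (x v : ℕ) : State :=
  { σ with reg := Function.update σ.reg x v }

/-- The state after `arr a [i] := v`. -/
def State.setArr (σ : State) (a i v : ℕ) : State :=
  { σ with arr := Function.update σ.arr a (Function.update (σ.arr a) i v) }

/-- `Exec P σ τ t`: started in state `σ`, the program `P` halts in state `τ` after time `t`. -/
inductive Exec : Prog → State → State → ℕ → Prop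
  | skip (σ : State) : Exec .skip σ σ 1
  | assign (σ : State) (x : ℕ) (e : AExp) :
      Exec (.assign x e) σ (σ.setReg x (e.val σ)) (1 + e.cost σ)
  | store (σ : State) (a : ℕ) (i e : AExp) :
      Exec (.store a i e) σ (σ.setArr a (i.val σ) (e.val σ)) (1 + i.cost σ + e.cost σ)
  | seq {P Q : Prog} {σ τ υ : State} {t u : ℕ} :
      Exec P σ τ t → Exec Q τ υ u → Exec (.seq P Q) σ υ (t + u)
  | iteTrue {e : AExp} {P Q : Prog} {σ τ : State} {t : ℕ} :
      e.val σ ≠ 0 → Exec P σ τ t → Exec (.ite e P Q) σ τ (1 + e.cost σ + t)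
  | iteFalse {e : AExp} {P Q : Prog} {σ τ : State} {t : ℕ} :
      e.val σ = 0 → Exec Q σ τ t → Exec (.ite e P Q) σ τ (1 + e.cost σ + t)
  | loopStop {e : AExp} {P : Prog} {σ : State} :
      e.val σ = 0 → Exec (.loop e P) σ σ (1 + e.cost σ)
  | loopStep {e : AExp} {P : Prog} {σ τ υ : State} {t u : ℕ} :
      e.val σ ≠ 0 → Exec P σ τ t → Exec (.loop e P) τ υ u →
      Exec (.loop e P) σ υ (1 + e.cost σ + t + u)

/-- Programs are deterministic, in their result and in their running time. -/
theorem Exec.det {P : Prog} {σ τ : State} {t : ℕ} (h : Exec P σ τ t) :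
    ∀ {τ' : State} {t' : ℕ}, Exec P σ τ' t' → τ = τ' ∧ t = t' := by
  induction h with
  | skip σ => intro _ _ h'; cases h'; exact ⟨rfl, rfl⟩
  | assign σ x e => intro _ _ h'; cases h'; exact ⟨rfl, rfl⟩
  | store σ a i e => intro _ _ h'; cases h'; exact ⟨rfl, rfl⟩
  | seq _ _ ih1 ih2 =>
    intro _ _ h'
    cases h' with
    | seq h1 h2 =>
      obtain ⟨rfl, rfl⟩ := ih1 h1
      obtain ⟨rfl, rfl⟩ := ih2 h2
      exact ⟨rfl, rfl⟩
  | iteTrue he _ ih =>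
    intro _ _ h'
    cases h' with
    | iteTrue _ h1 => obtain ⟨rfl, rfl⟩ := ih h1; exact ⟨rfl, rfl⟩
    | iteFalse he' _ => exact absurd he' he
  | iteFalse he _ ih =>
    intro _ _ h'
    cases h' with
    | iteFalse _ h1 => obtain ⟨rfl, rfl⟩ := ih h1; exact ⟨rfl, rfl⟩
    | iteTrue he' _ => exact absurd he he'
  | loopStop he =>
    intro _ _ h'
    cases h' with
    | loopStop _ => exact ⟨rfl, rfl⟩
    | loopStep he' _ _ => exact absurd he he'
  | loopStep he _ _ ih1 ih2 =>
    intro _ _ h'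
    cases h' with
    | loopStop he' => exact absurd he' he
    | loopStep _ h1 h2 =>
      obtain ⟨rfl, rfl⟩ := ih1 h1
      obtain ⟨rfl, rfl⟩ := ih2 h2
      exact ⟨rfl, rfl⟩

/-- The initial state on an instance: `reg 0` holds `n`, `arr 0` holds the `p i`, and everything
else is zero. -/
def Inst.init (I : Inst) : State where
  reg := fun x => if x = 0 then I.n else 0
  arr := fun a i => if h : a = 0 ∧ i < I.n then I.p ⟨i, h.2⟩ else 0

/-- The schedule that a final state describes: job `i` starts at time `arr 1 [i]`. -/
def Inst.output (I : Inst) (τ : State) : Fin I.n → ℝ := fun i => (τ.arr 1 i : ℝ)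

/-- Quasi-polynomially bounded functions: `T N ≤ 2 ^ (c * (log N + 1) ^ k)` for constants `c`
and `k`. -/
def QuasiPolynomial (T : ℕ → ℕ) : Prop :=
  ∃ c k : ℕ, ∀ N, T N ≤ 2 ^ (c * (Nat.log 2 N + 1) ^ k)

end TriangleScheduling

/-! Place the jobs in order of decreasing size. A job only has to keep its own size as distance from
the larger jobs already present, so inserting it cuts one gap into two parts, each at least as long
as the job. After a rotation that puts the largest job at time 0 (`Inst.Feasible.exists_rotation`),
every job is followed by exactly one gap, and a schedule becomes a sequence of binary splits of a
single gap, the total length (`splits_of_separated`). Only the multiset of gap lengths matters for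
what can still be inserted.

Gap lengths are therefore restricted to a geometric grid of ratio about `1 + 1 / F`. With
polylogarithmically many classes `K`, a multiset of at most `n` gaps is a number below `(n + 1) ^
K`, which is quasi-polynomial, and a dynamic program over these numbers and the number of remaining
jobs finds the shortest grid length that works.

The difficulty is the rounding error: the tree of splits can have depth about `n`, and rounding at
every split would compound that many factors. The remedy is to compare jobs on a coarse grid of
ratio about `1 + 1 / E`, in units of `p 0 / (n * E)`; there are only `O(E log n)` levels. While the
level is constant all jobs have the same requirement, so the order of the splits is free, and a gap
that ends up in many pieces can be cut along a balanced tree of depth `log n`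
(`exists_reaches_singleton`). Rounding thus costs a power of `1 + 1 / F` with exponent about (number
of levels) times `log n` (`Splits.exists_good_aux`), and `precision` chooses `F` so that this power
is at most `1 + 2 / E`. Rounding the jobs to units and levels costs further factors `1 + O(1 / E)`
(`Inst.exists_good`). The levels serve the existence argument only: the program tests the true
sizes, through `Inst.Fits`.

The rest is the program and its analysis: the loop invariants give correctness and a bound on all
stored numbers, and `Prog.exec_loop` turns invariant and variant into a bit-cost bound. -/

namespace TriangleScheduling

/-! ## Cost bounds for programs -/

/-- All registers and array entries are at most `M`. -/
def State.Bdd (M : ℕ) (σ : State) : Prop :=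
  (∀ x, σ.reg x ≤ M) ∧ ∀ a i, σ.arr a i ≤ M

/-- All registers and array entries have bit length at most `β`. -/
def State.BitBdd (β : ℕ) (σ : State) : Prop :=
  (∀ x, (σ.reg x).size ≤ β) ∧ ∀ a i, (σ.arr a i).size ≤ β

theorem State.Bdd.bitBdd {M : ℕ} {σ : State} (h : σ.Bdd M) : σ.BitBdd M.size :=
  ⟨fun x => Nat.size_le_size (h.1 x), fun a i => Nat.size_le_size (h.2 a i)⟩

theorem State.BitBdd.mono {β γ : ℕ} {σ : State} (h : σ.BitBdd β) (hβ : β ≤ γ) : σ.BitBdd γ :=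
  ⟨fun x => (h.1 x).trans hβ, fun a i => (h.2 a i).trans hβ⟩

theorem State.Bdd.setReg {M : ℕ} {σ : State} (h : σ.Bdd M) {x v : ℕ} (hv : v ≤ M) :
    (σ.setReg x v).Bdd M := by
  refine ⟨fun y => ?_, h.2⟩
  simp only [State.setReg, Function.update_apply]
  split_ifs
  exacts [hv, h.1 y]

theorem State.Bdd.setArr {M : ℕ} {σ : State} (h : σ.Bdd M) {a i v : ℕ} (hv : v ≤ M) :
    (σ.setArr a i v).Bdd M := by
  refine ⟨h.1, fun b j => ?_⟩
  simp only [State.setArr, Function.update_apply]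
  split_ifs with h1
  · rw [Function.update_apply]
    split_ifs
    exacts [hv, h.2 _ _]
  · exact h.2 b j

theorem State.BitBdd.setReg {M : ℕ} {σ : State} (h : σ.BitBdd M) {x v : ℕ} (hv : v.size ≤ M) :
    (σ.setReg x v).BitBdd M := by
  refine ⟨fun y => ?_, h.2⟩
  simp only [State.setReg, Function.update_apply]
  split_ifs
  exacts [hv, h.1 y]

theorem State.BitBdd.setArr {M : ℕ} {σ : State} (h : σ.BitBdd M) {a i v : ℕ} (hv : v.size ≤ M) :
    (σ.setArr a i v).BitBdd M := by
  refine ⟨h.1, fun b j => ?_⟩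
  simp only [State.setArr, Function.update_apply]
  split_ifs with h1
  · rw [Function.update_apply]
    split_ifs
    exacts [hv, h.2 _ _]
  · exact h.2 b j

/-- The size of an expression, constants counted with their bit length. -/
def AExp.nodes : AExp → ℕ
  | const k => 1 + k.size
  | reg _ => 1
  | load _ i => i.nodes + 1
  | add e f => e.nodes + f.nodes + 1
  | sub e f => e.nodes + f.nodes + 1
  | mul e f => e.nodes + f.nodes + 1
  | div e f => e.nodes + f.nodes + 1

theorem AExp.nodes_pos (e : AExp) : 1 ≤ e.nodes := by
  cases e <;> simp [AExp.nodes]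

theorem AExp.size_val_le {β : ℕ} {σ : State} (h : σ.BitBdd β) (e : AExp) :
    (e.val σ).size ≤ e.nodes * (β + 1) := by
  induction e with
  | const k => simp only [val, nodes]; nlinarith
  | reg x => simp only [val, nodes]; have := h.1 x; omega
  | load a i ih => simp only [val, nodes]; have := h.2 a (i.val σ); nlinarith
  | add e f he hf =>
    simp only [val, nodes]
    rw [Nat.size_le] at *
    have h1 : 2 ^ (e.nodes * (β + 1)) ≤ 2 ^ ((e.nodes + f.nodes) * (β + 1)) :=
      Nat.pow_le_pow_right (by norm_num) (by nlinarith)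
    have h2 : 2 ^ (f.nodes * (β + 1)) ≤ 2 ^ ((e.nodes + f.nodes) * (β + 1)) :=
      Nat.pow_le_pow_right (by norm_num) (by nlinarith)
    have h3 : 2 ^ ((e.nodes + f.nodes) * (β + 1) + 1) ≤
        2 ^ ((e.nodes + f.nodes + 1) * (β + 1)) :=
      Nat.pow_le_pow_right (by norm_num) (by nlinarith)
    rw [pow_succ] at h3
    omega
  | sub e f he hf =>
    simp only [val, nodes]
    exact (Nat.size_le_size (Nat.sub_le _ _)).trans (he.trans (by nlinarith))
  | mul e f he hf =>
    simp only [val, nodes]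
    rw [Nat.size_le] at *
    calc e.val σ * f.val σ < 2 ^ (e.nodes * (β + 1)) * 2 ^ (f.nodes * (β + 1)) :=
          Nat.mul_lt_mul'' he hf
      _ = 2 ^ (e.nodes * (β + 1) + f.nodes * (β + 1)) := (pow_add _ _ _).symm
      _ ≤ _ := Nat.pow_le_pow_right (by norm_num) (by nlinarith)
  | div e f he hf =>
    simp only [val, nodes]
    exact (Nat.size_le_size (Nat.div_le_self _ _)).trans (he.trans (by nlinarith))

/-- The cost is a sum over at most `nodes` subexpressions, each with a value of at most `nodes * (β
+ 1)` bits; hence the square. -/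
theorem AExp.cost_le {β : ℕ} {σ : State} (h : σ.BitBdd β) (e : AExp) :
    e.cost σ ≤ e.nodes ^ 2 * (β + 2) := by
  have key : ∀ a b c d s : ℕ, c ≤ a ^ 2 * (β + 2) → d ≤ b ^ 2 * (β + 2) →
      s ≤ (a + b + 1) * (β + 1) → c + d + (1 + s) ≤ (a + b + 1) ^ 2 * (β + 2) := by
    intro a b c d s hc hd hs
    have h1 : (a + b + 1) ^ 2 * (β + 2) = a ^ 2 * (β + 2) + b ^ 2 * (β + 2) +
        (a + b + 1) * (β + 1) + 1 + (a + b + (2 * a * b + a + b) * (β + 2)) := by ring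
    omega
  induction e with
  | const k =>
    simp only [cost, nodes]
    calc 1 + k.size ≤ (1 + k.size) * 2 := by omega
      _ ≤ (1 + k.size) ^ 2 * (β + 2) := by gcongr <;> nlinarith
  | reg x => simp only [cost, nodes]; have := h.1 x; omega
  | load a i ih =>
    have h1 := h.2 a (i.val σ)
    have := key i.nodes 0 _ 0 (σ.arr a (i.val σ)).size ih (by simp) (by nlinarith)
    simpa [cost, nodes] using this
  | add e f he hf => exact key _ _ _ _ _ he hf (size_val_le h (.add e f))
  | sub e f he hf => exact key _ _ _ _ _ he hf (size_val_le h (.sub e f))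
  | mul e f he hf => exact key _ _ _ _ _ he hf (size_val_le h (.mul e f))
  | div e f he hf => exact key _ _ _ _ _ he hf (size_val_le h (.div e f))

/-- Programs without loops. -/
def Prog.Straight : Prog → Prop
  | skip => True
  | assign _ _ => True
  | store _ _ _ => True
  | seq P Q => P.Straight ∧ Q.Straight
  | ite _ P Q => P.Straight ∧ Q.Straight
  | loop _ _ => False

/-- The effect of a program without loops. -/
def Prog.run : Prog → State → State
  | skip, σ => σ
  | assign x e, σ => σ.setReg x (e.val σ)
  | store a i e, σ => σ.setArr a (i.val σ) (e.val σ)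
  | seq P Q, σ => Q.run (P.run σ)
  | ite e P Q, σ => if e.val σ ≠ 0 then P.run σ else Q.run σ
  | loop _ _, σ => σ

/-- Growth of the bit lengths is tracked together with time, because in a sequence the second
program pays for the numbers left by the first. The constant depends on the program alone, which
makes the final bound uniform in the instance. -/
theorem Prog.exec_run (P : Prog) (hP : P.Straight) : ∃ C, ∀ β σ, σ.BitBdd β →
    (P.run σ).BitBdd (C * (β + 1)) ∧ ∃ t ≤ C * (β + 1), Exec P σ (P.run σ) t := by
  induction P with
  | skip =>
    exact ⟨1, fun β σ h => ⟨h.mono (by omega), 1, by omega, Exec.skip σ⟩⟩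
  | assign x e =>
    refine ⟨1 + 2 * e.nodes ^ 2 + e.nodes, fun β σ h => ⟨?_, _, ?_, Exec.assign σ x e⟩⟩
    · have := e.nodes_pos
      exact (h.mono (by nlinarith)).setReg ((e.size_val_le h).trans (by gcongr; omega))
    · have := e.cost_le h
      nlinarith
  | store a i e =>
    refine ⟨1 + 2 * i.nodes ^ 2 + 2 * e.nodes ^ 2 + e.nodes,
      fun β σ h => ⟨?_, _, ?_, Exec.store σ a i e⟩⟩
    · have := e.nodes_pos
      exact (h.mono (by nlinarith)).setArr ((e.size_val_le h).trans (by gcongr; omega))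
    · have := e.cost_le h
      have := i.cost_le h
      nlinarith
  | seq P Q hp hq =>
    obtain ⟨C, hC⟩ := hp hP.1
    obtain ⟨D, hD⟩ := hq hP.2
    refine ⟨C + D * (C + 1), fun β σ h => ?_⟩
    obtain ⟨h1, t, ht, ht'⟩ := hC β σ h
    obtain ⟨h2, u, hu, hu'⟩ := hD _ _ h1
    have h3 : D * (C * (β + 1) + 1) ≤ D * (C + 1) * (β + 1) := by
      rw [mul_assoc]
      exact Nat.mul_le_mul_left _ (by nlinarith)
    refine ⟨h2.mono (by nlinarith), t + u, by nlinarith, Exec.seq ht' hu'⟩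
  | ite e P Q hp hq =>
    obtain ⟨C, hC⟩ := hp hP.1
    obtain ⟨D, hD⟩ := hq hP.2
    refine ⟨1 + 2 * e.nodes ^ 2 + C + D, fun β σ h => ?_⟩
    have hc := e.cost_le h
    by_cases he : e.val σ = 0
    · obtain ⟨h1, t, ht, ht'⟩ := hD β σ h
      simp only [Prog.run, he, ne_eq, not_true_eq_false, if_false]
      exact ⟨h1.mono (by nlinarith), _, by nlinarith, Exec.iteFalse he ht'⟩
    · obtain ⟨h1, t, ht, ht'⟩ := hC β σ h
      simp only [Prog.run, he, ne_eq, not_false_eq_true, if_true]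
      exact ⟨h1.mono (by nlinarith), _, by nlinarith, Exec.iteTrue he ht'⟩
  | loop e P => exact hP.elim

/-- Loop-free code, with its cost in terms of a bound on the values in the initial state. -/
theorem Prog.exec_straight (P : Prog) (hP : P.Straight) : ∃ C, ∀ M σ, σ.Bdd M →
    ∃ t ≤ C * (M.size + 1), Exec P σ (P.run σ) t := by
  obtain ⟨C, hC⟩ := P.exec_run hP
  exact ⟨C, fun M σ h => (hC _ σ h.bitBdd).2⟩

/-- The rule for loops with loop-free bodies: invariant `Inv`, variant `μ`. -/
theorem Prog.exec_loop (e : AExp) (P : Prog) (hP : P.Straight) :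
    ∃ C, ∀ (M : ℕ) (Inv : State → Prop) (μ : State → ℕ), (∀ σ, Inv σ → σ.Bdd M) →
      (∀ σ, Inv σ → e.val σ ≠ 0 → Inv (P.run σ) ∧ μ (P.run σ) < μ σ) →
      ∀ σ, Inv σ → ∃ τ t, Exec (.loop e P) σ τ t ∧ t ≤ C * ((μ σ + 1) * (M.size + 1)) ∧
        Inv τ ∧ e.val τ = 0 := by
  obtain ⟨C, hC⟩ := P.exec_straight hP
  refine ⟨C + 1 + 2 * e.nodes ^ 2, fun M Inv μ hB hI σ => ?_⟩
  induction hm : μ σ using Nat.strong_induction_on generalizing σ with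
  | _ m ih =>
    intro hσ
    have hc := e.cost_le (hB σ hσ).bitBdd
    by_cases he : e.val σ = 0
    · refine ⟨σ, _, Exec.loopStop he, ?_, hσ, he⟩
      have : 1 * (M.size + 1) ≤ (m + 1) * (M.size + 1) := by gcongr; omega
      calc 1 + e.cost σ ≤ (C + 1 + 2 * e.nodes ^ 2) * (1 * (M.size + 1)) := by nlinarith
        _ ≤ _ := Nat.mul_le_mul_left _ this
    · obtain ⟨t, ht, ht'⟩ := hC M σ (hB σ hσ)
      obtain ⟨h1, h2⟩ := hI σ hσ he
      obtain ⟨τ, u, hu, hu', hτ, hτ'⟩ := ih _ (hm ▸ h2) _ rfl h1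
      refine ⟨τ, _, Exec.loopStep he ht' hu, ?_, hτ, hτ'⟩
      have h3 : (μ (P.run σ) + 1) * (M.size + 1) + (M.size + 1) ≤ (m + 1) * (M.size + 1) := by
        have : μ (P.run σ) + 1 + 1 ≤ m + 1 := by omega
        nlinarith
      calc 1 + e.cost σ + t + u ≤ (C + 1 + 2 * e.nodes ^ 2) *
            ((μ (P.run σ) + 1) * (M.size + 1) + (M.size + 1)) := by nlinarith
        _ ≤ _ := Nat.mul_le_mul_left _ h3

/-! ## Geometric grids -/

/-- A grid of integers in which consecutive elements differ by a factor of about `1 + 1 / F`. -/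
def grid (F : ℕ) : ℕ → ℕ
  | 0 => 1
  | k + 1 => grid F k + 1 + grid F k / F

theorem grid_strictMono (F : ℕ) : StrictMono (grid F) :=
  strictMono_nat_of_lt_succ fun k => by
    have : grid F (k + 1) = grid F k + 1 + grid F k / F := rfl
    rw [this]
    exact Nat.lt_of_lt_of_le (Nat.lt_succ_self _) (Nat.le_add_right _ _)

theorem grid_pos (F k : ℕ) : 1 ≤ grid F k :=
  (grid_strictMono F).monotone (Nat.zero_le k)

/-- Take the least grid element that is at least `v`. Its predecessor is below `v`, and the `+ 1` in
the recursion is absorbed because both are integers. -/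
theorem exists_grid (F : ℕ) {v : ℕ} (hv : 1 ≤ v) :
    ∃ k, v ≤ grid F k ∧ F * grid F k ≤ (F + 1) * v := by
  have hex : ∃ k, v ≤ grid F k := ⟨v, (grid_strictMono F).le_apply⟩
  classical
  refine ⟨Nat.find hex, Nat.find_spec hex, ?_⟩
  rcases hk : Nat.find hex with _ | k
  · simp only [grid]; nlinarith
  · have h1 : grid F k < v := by
      have := Nat.find_min hex (m := k) (by omega)
      omega
    have h2 : F * (grid F k / F) ≤ grid F k := Nat.mul_div_le _ _
    have h3 : F * (grid F k + 1) ≤ F * v := Nat.mul_le_mul_left _ h1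
    calc F * grid F (k + 1) = F * (grid F k + 1) + F * (grid F k / F) := by
          simp only [grid]; ring
      _ ≤ (F + 1) * v := by nlinarith

/-- Each of `F` consecutive steps adds at least a fraction `1 / F` of the value at the start of the
block, so every block doubles the grid. This keeps the number of classes at `F` times a logarithm.
-/
theorem two_pow_le_grid {F : ℕ} (hF : 0 < F) (L : ℕ) : 2 ^ L ≤ grid F (F * L) := by
  induction L with
  | zero => exact grid_pos _ _
  | succ L ih =>
    have key : ∀ i, F * grid F (F * L) + i * grid F (F * L) ≤ F * grid F (F * L + i) := by
      intro i
      induction i with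
      | zero => simp
      | succ i ihi =>
        have h1 : grid F (F * L) ≤ grid F (F * L + i) :=
          (grid_strictMono F).monotone (by omega)
        have h2 : grid F (F * L + i) < F * (grid F (F * L + i) / F + 1) :=
          Nat.lt_mul_div_succ _ hF
        have h3 : grid F (F * L + (i + 1)) =
            grid F (F * L + i) + 1 + grid F (F * L + i) / F := rfl
        rw [h3]
        nlinarith
    have h := key F
    have h4 : F * (2 * grid F (F * L)) ≤ F * grid F (F * L + F) := by nlinarith
    have h5 := Nat.le_of_mul_le_mul_left h4 hF
    calc 2 ^ (L + 1) = 2 * 2 ^ L := by ring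
      _ ≤ 2 * grid F (F * L) := Nat.mul_le_mul_left _ ih
      _ ≤ _ := h5

theorem grid_le_two_pow (F k : ℕ) : grid F k + 1 ≤ 2 ^ (k + 1) := by
  induction k with
  | zero => simp [grid]
  | succ k ih =>
    have h1 : grid F k / F ≤ grid F k := Nat.div_le_self _ _
    have h2 : grid F (k + 1) = grid F k + 1 + grid F k / F := rfl
    rw [pow_succ]
    omega

/-! ## Splitting gaps -/

/-- One gap of class `c` is split into gaps of classes `a` and `b` of sizes at least `r`. -/
def Split (g : ℕ → ℕ) (r : ℕ) (W W' : Multiset ℕ) : Prop :=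
  ∃ a b c R, W = c ::ₘ R ∧ W' = a ::ₘ b ::ₘ R ∧ g a + g b ≤ g c ∧ r ≤ g a ∧ r ≤ g b

/-- The gaps of classes `W` can take `m` further jobs, if job `j` needs gaps satisfying `ok j`. -/
def Good (g : ℕ → ℕ) (ok : ℕ → ℕ → Prop) : ℕ → Multiset ℕ → Prop
  | 0, _ => True
  | m + 1, W => ∃ a b c R, W = c ::ₘ R ∧ g a + g b ≤ g c ∧ ok (Multiset.card W) (g a) ∧
      ok (Multiset.card W) (g b) ∧ Good g ok m (a ::ₘ b ::ₘ R)

/-- The gaps in `S` can be split exactly `m` more times, where job `j` needs gaps of size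
at least `r j`. -/
def Splits (r : ℕ → ℕ) : ℕ → Multiset ℕ → Prop
  | 0, _ => True
  | m + 1, S => ∃ a b R, S = (a + b) ::ₘ R ∧ r (Multiset.card S) ≤ a ∧ r (Multiset.card S) ≤ b ∧
      Splits r m (a ::ₘ b ::ₘ R)

theorem Split.add_right {g : ℕ → ℕ} {r : ℕ} {W W' : Multiset ℕ} (h : Split g r W W')
    (V : Multiset ℕ) : Split g r (W + V) (W' + V) := by
  obtain ⟨a, b, c, R, rfl, rfl, h1, h2, h3⟩ := h
  exact ⟨a, b, c, R + V, by simp, by simp, h1, h2, h3⟩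

/-- Iterated splitting. -/
def Reaches (g : ℕ → ℕ) (r : ℕ) : Multiset ℕ → Multiset ℕ → Prop :=
  Relation.ReflTransGen (Split g r)

theorem Reaches.add_right {g : ℕ → ℕ} {r : ℕ} {W W' : Multiset ℕ} (h : Reaches g r W W')
    (V : Multiset ℕ) : Reaches g r (W + V) (W' + V) := by
  induction h with
  | refl => exact Relation.ReflTransGen.refl
  | tail _ h ih => exact ih.tail (h.add_right V)

theorem Reaches.add {g : ℕ → ℕ} {r : ℕ} {W W' V V' : Multiset ℕ} (h : Reaches g r W W')
    (h' : Reaches g r V V') : Reaches g r (W + V) (W' + V') := by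
  refine Relation.ReflTransGen.trans (h.add_right V) ?_
  rw [add_comm W', add_comm W']
  exact h'.add_right W'

/-- The splits leading from `C` to `W` insert exactly the jobs numbered from `card C` to `card W -
1` (the next job is always numbered by the current number of gaps). If all of them accept gaps of
size `r`, these splits can be prefixed to the solution from `W`. -/
theorem good_of_reaches {g : ℕ → ℕ} {ok : ℕ → ℕ → Prop} {r n : ℕ} {C W : Multiset ℕ}
    (h : Reaches g r C W) (hn : Multiset.card W ≤ n) (hG : Good g ok (n - Multiset.card W) W) :
    Multiset.card C ≤ Multiset.card W ∧
    ((∀ l, Multiset.card C ≤ l → l < Multiset.card W → ∀ v, r ≤ v → ok l v) →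
      Good g ok (n - Multiset.card C) C) := by
  induction h using Relation.ReflTransGen.head_induction_on with
  | refl => exact ⟨le_rfl, fun _ => hG⟩
  | head h _ ih =>
    obtain ⟨a, b, c, R, rfl, rfl, h1, h2, h3⟩ := h
    simp only [Multiset.card_cons] at ih ⊢
    refine ⟨by omega, fun hok => ?_⟩
    have h4 := ih.2 fun l hl => hok l (by omega)
    have h5 : n - (Multiset.card R + 1) = n - (Multiset.card R + 1 + 1) + 1 := by omega
    rw [h5]
    refine ⟨a, b, c, R, rfl, h1, ?_, ?_, h4⟩
    · exact hok _ (by simp) (by simp only [Multiset.card_cons]; omega) _ h2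
    · exact hok _ (by simp) (by simp only [Multiset.card_cons]; omega) _ h3

theorem exists_grid_real {F : ℕ} (hF : 0 < F) {v : ℕ} (hv : 1 ≤ v) :
    ∃ k, v ≤ grid F k ∧ (grid F k : ℝ) ≤ (1 + 1 / F) * v := by
  obtain ⟨k, h1, h2⟩ := exists_grid F hv
  refine ⟨k, h1, ?_⟩
  have h3 : (F : ℝ) * grid F k ≤ (F + 1) * v := by exact_mod_cast h2
  have hF' : (0 : ℝ) < F := by exact_mod_cast hF
  rw [show (1 + 1 / (F : ℝ)) * v = (F + 1) * v / F by field_simp, le_div_iff₀ hF']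
  linarith

/-- Merge the pieces along a balanced binary tree, rounding up to the grid at each node. The error
is governed by the depth `h`, not by the number of pieces. This is legitimate only because a single
threshold `r` applies to all splits. -/
theorem exists_reaches_singleton {F r : ℕ} (hF : 0 < F) (h : ℕ) :
    ∀ W : Multiset ℕ, W ≠ 0 → Multiset.card W ≤ 2 ^ h → (∀ c ∈ W, r ≤ grid F c) →
      ∃ c, (W.map (grid F)).sum ≤ grid F c ∧
        (grid F c : ℝ) ≤ (1 + 1 / F) ^ h * ((W.map (grid F)).sum : ℕ) ∧
        Reaches (grid F) r {c} W := by
  have hlam : (1 : ℝ) ≤ 1 + 1 / F := by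
    have : (0 : ℝ) ≤ 1 / F := by positivity
    linarith
  induction h with
  | zero =>
    intro W hW hc hr
    have : Multiset.card W = 1 := by
      have := Multiset.card_pos.2 hW
      simp at hc; omega
    obtain ⟨c, rfl⟩ := Multiset.card_eq_one.1 this
    exact ⟨c, by simp, by simp, Relation.ReflTransGen.refl⟩
  | succ h ih =>
    intro W hW hc hr
    have hpos := Multiset.card_pos.2 hW
    rcases Nat.eq_or_lt_of_le hpos with h1 | h1
    · obtain ⟨c, rfl⟩ := Multiset.card_eq_one.1 h1.symm
      refine ⟨c, by simp, ?_, Relation.ReflTransGen.refl⟩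
      simpa using le_mul_of_one_le_left (Nat.cast_nonneg (grid F c)) (one_le_pow₀ hlam)
    · obtain ⟨A, B, rfl, hA, hA', hB, hB'⟩ : ∃ A B : Multiset ℕ, W = A + B ∧ A ≠ 0 ∧
          Multiset.card A ≤ 2 ^ h ∧ B ≠ 0 ∧ Multiset.card B ≤ 2 ^ h := by
        rw [pow_succ] at hc
        refine ⟨(W.toList.take (Multiset.card W / 2) : List ℕ),
          (W.toList.drop (Multiset.card W / 2) : List ℕ), ?_, ?_, ?_, ?_, ?_⟩
        · rw [Multiset.coe_add, List.take_append_drop, Multiset.coe_toList]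
        · rw [← Multiset.card_pos]; simp; omega
        · simp; omega
        · rw [← Multiset.card_pos]; simp; omega
        · simp; omega
      obtain ⟨a, ha1, ha2, ha3⟩ := ih A hA hA' fun c hc => hr c (Multiset.mem_add.2 (.inl hc))
      obtain ⟨b, hb1, hb2, hb3⟩ := ih B hB hB' fun c hc => hr c (Multiset.mem_add.2 (.inr hc))
      obtain ⟨c, hc1, hc2⟩ := exists_grid_real hF (v := grid F a + grid F b)
        (by have := grid_pos F a; omega)
      -- A nonempty half is at least as long as one of its pieces, so the inner nodes of the tree
      -- also respect the threshold `r`.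
      have hle : ∀ V : Multiset ℕ, V ≠ 0 → (∀ c ∈ V, r ≤ grid F c) →
          r ≤ (V.map (grid F)).sum := by
        intro V hV hr
        obtain ⟨x, hx⟩ := Multiset.exists_mem_of_ne_zero hV
        exact (hr x hx).trans (Multiset.le_sum_of_mem (Multiset.mem_map_of_mem _ hx))
      have hra := (hle A hA fun c hc => hr c (Multiset.mem_add.2 (.inl hc))).trans ha1
      have hrb := (hle B hB fun c hc => hr c (Multiset.mem_add.2 (.inr hc))).trans hb1
      refine ⟨c, ?_, ?_, ?_⟩
      · rw [Multiset.map_add, Multiset.sum_add]; omega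
      · rw [Multiset.map_add, Multiset.sum_add]
        push_cast at hc2 ⊢
        rw [pow_succ]
        calc (grid F c : ℝ) ≤ (1 + 1 / F) * (grid F a + grid F b) := hc2
          _ ≤ (1 + 1 / F) * ((1 + 1 / F) ^ h * ((A.map (grid F)).sum : ℕ) +
              (1 + 1 / F) ^ h * ((B.map (grid F)).sum : ℕ)) := by gcongr
          _ = _ := by push_cast; ring
      · refine Relation.ReflTransGen.head ⟨a, b, c, 0, rfl, rfl, hc1, hra, hrb⟩ ?_
        exact ha3.add hb3

/-- `W` refines `S`: each `v ∈ S` stands for a part of `W` of total size at least `v`. -/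
def Refines (g : ℕ → ℕ) (S W : Multiset ℕ) : Prop :=
  ∃ P : Multiset (Multiset ℕ),
    Multiset.Rel (fun v A => v ≤ (A.map g).sum ∧ A ≠ 0) S P ∧ P.join = W

theorem refines_of_rel {g : ℕ → ℕ} {S W : Multiset ℕ}
    (h : Multiset.Rel (fun v c => v ≤ g c) S W) : Refines g S W := by
  refine ⟨W.map fun c => {c}, ?_, ?_⟩
  · rw [Multiset.rel_map_right]
    exact h.mono fun a _ b _ hab => ⟨by simpa using hab, by simp⟩
  · rw [Multiset.join]
    exact Multiset.sum_map_singleton W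

/-- Going backwards over a split joins two groups without any rounding; this is what makes splits
inside a stage free of cost. -/
theorem Refines.merge {g : ℕ → ℕ} {a b : ℕ} {R W : Multiset ℕ}
    (h : Refines g (a ::ₘ b ::ₘ R) W) : Refines g ((a + b) ::ₘ R) W := by
  obtain ⟨P, hP, rfl⟩ := h
  rw [Multiset.rel_cons_left] at hP
  obtain ⟨A, P', hA, hP', rfl⟩ := hP
  rw [Multiset.rel_cons_left] at hP'
  obtain ⟨B, P'', hB, hP'', rfl⟩ := hP'
  refine ⟨(A + B) ::ₘ P'', Multiset.Rel.cons ⟨?_, ?_⟩ hP'', by simp [add_assoc]⟩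
  · rw [Multiset.map_add, Multiset.sum_add]; exact add_le_add hA.1 hB.1
  · intro h
    exact hA.2 (add_eq_zero.1 h).1

/-- The end of a stage, read backwards: every group collapses to one class, and since the groups are
disjoint the error is again one factor of depth `h` for the whole multiset. -/
theorem Refines.exists_reaches {F r h : ℕ} (hF : 0 < F) {S W : Multiset ℕ}
    (hR : Refines (grid F) S W) (hW : Multiset.card W ≤ 2 ^ h) (hr : ∀ c ∈ W, r ≤ grid F c) :
    ∃ C, Multiset.Rel (fun v c => v ≤ grid F c) S C ∧
      (((C.map (grid F)).sum : ℕ) : ℝ) ≤ (1 + 1 / F) ^ h * ((W.map (grid F)).sum : ℕ) ∧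
      Reaches (grid F) r C W := by
  obtain ⟨P, hP, rfl⟩ := hR
  induction hP with
  | zero => exact ⟨0, Multiset.Rel.zero, by simp, Relation.ReflTransGen.refl⟩
  | @cons v A S P hv _ ih =>
    rw [Multiset.join_cons, Multiset.card_add] at hW
    simp only [Multiset.join_cons, Multiset.mem_add] at hr
    obtain ⟨C, hC1, hC2, hC3⟩ := ih (by omega) fun c hc => hr c (.inr hc)
    obtain ⟨c, hc1, hc2, hc3⟩ := exists_reaches_singleton hF h A hv.2 (by omega)
      fun c hc => hr c (.inl hc)
    refine ⟨c ::ₘ C, hC1.cons (hv.1.trans hc1), ?_, ?_⟩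
    · rw [Multiset.join_cons, Multiset.map_add, Multiset.sum_add, Multiset.map_cons,
        Multiset.sum_cons]
      push_cast
      push_cast at hc2 hC2
      linarith
    · rw [Multiset.join_cons, ← Multiset.singleton_add]
      exact hc3.add hC3

theorem exists_rel_grid {F : ℕ} (hF : 0 < F) (S : Multiset ℕ) (hS : ∀ v ∈ S, 1 ≤ v) :
    ∃ W, Multiset.Rel (fun v c => v ≤ grid F c) S W ∧
      (((W.map (grid F)).sum : ℕ) : ℝ) ≤ (1 + 1 / F) * (S.sum : ℕ) := by
  induction S using Multiset.induction_on with
  | empty => exact ⟨0, Multiset.Rel.zero, by simp⟩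
  | cons v S ih =>
    obtain ⟨W, h1, h2⟩ := ih fun w hw => hS w (Multiset.mem_cons_of_mem hw)
    obtain ⟨c, h3, h4⟩ := exists_grid_real hF (hS v (Multiset.mem_cons_self v S))
    refine ⟨c ::ₘ W, h1.cons h3, ?_⟩
    rw [Multiset.map_cons, Multiset.sum_cons, Multiset.sum_cons]
    push_cast
    push_cast at h2
    linarith

theorem rel_le_mem {g : ℕ → ℕ} {r : ℕ} {S W : Multiset ℕ}
    (h : Multiset.Rel (fun v c => v ≤ g c) S W) (hS : ∀ v ∈ S, r ≤ v) : ∀ c ∈ W, r ≤ g c := by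
  intro c hc
  obtain ⟨v, hv, hvc⟩ := Multiset.exists_mem_of_rel_of_mem (r := fun c v => v ≤ g c)
    (Multiset.rel_flip.2 h) hc
  exact (hS v hv).trans hvc

/-- A sequence of exact splits is rounded to one between grid elements, in stages of constant
`e`; each stage and the initial rounding cost powers of `1 + 1 / F`. -/
theorem Splits.exists_good_aux {F h n : ℕ} (hF : 0 < F) (hn : n ≤ 2 ^ h) {ρ e : ℕ → ℕ}
    (hρ : ∀ k, 1 ≤ ρ k) (hρm : Monotone ρ) (he : Antitone e) {ok : ℕ → ℕ → Prop}
    (hok : ∀ j v, ρ (e j) ≤ v → ok j v) (m : ℕ) :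
    ∀ (S : Multiset ℕ) (j : ℕ), Multiset.card S = j + 1 → m + (j + 1) = n →
      Splits (fun j => ρ (e j)) m S → (∀ v ∈ S, ρ (e j) ≤ v) →
      ∃ W, Refines (grid F) S W ∧ Multiset.card W ≤ n ∧ (∀ c ∈ W, ρ (e j) ≤ grid F c) ∧
        (∀ l, j ≤ l → l < Multiset.card W → e l = e j) ∧
        Good (grid F) ok (n - Multiset.card W) W ∧
        (((W.map (grid F)).sum : ℕ) : ℝ) ≤ (1 + 1 / F) ^ (h * e j + 1) * (S.sum : ℕ) := by
  have hlam : (1 : ℝ) ≤ 1 + 1 / F := by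
    have : (0 : ℝ) ≤ 1 / F := by positivity
    linarith
  induction m with
  | zero =>
    intro S j hS hm _ hr
    obtain ⟨W, h1, h2⟩ := exists_rel_grid hF S fun v hv => (hρ _).trans (hr v hv)
    have hc := Multiset.card_eq_card_of_rel h1
    refine ⟨W, refines_of_rel h1, by omega, rel_le_mem h1 hr, ?_, ?_, h2.trans ?_⟩
    · intro l h3 h4
      rw [show l = j by omega]
    · rw [show n - Multiset.card W = 0 by omega]
      trivial
    · gcongr
      exact le_self_pow₀ hlam (by omega)
  | succ m ih =>
    intro S j hS hm hSp hr
    obtain ⟨a, b, R, rfl, ha, hb, hSp'⟩ := hSp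
    rw [hS] at ha hb
    have hR : Multiset.card R = j := by simpa using hS
    have hej : e (j + 1) ≤ e j := he (Nat.le_succ j)
    have hr' : ∀ v ∈ a ::ₘ b ::ₘ R, ρ (e (j + 1)) ≤ v := by
      intro v hv
      simp only [Multiset.mem_cons] at hv
      rcases hv with rfl | rfl | hv
      exacts [ha, hb, (hρm hej).trans (hr v (Multiset.mem_cons_of_mem hv))]
    obtain ⟨W, h1, h2, h3, h4, h5, h6⟩ := ih (a ::ₘ b ::ₘ R) (j + 1) (by simp [hR]) (by omega)
      hSp' hr'
    have hsum : (a ::ₘ b ::ₘ R).sum = ((a + b) ::ₘ R).sum := by simp [add_assoc]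
    rw [hsum] at h6
    -- If the level is unchanged, the two parts are merged lazily and `W` is kept. If it changes,
    -- the groups are collapsed first; the level increases strictly in this backward direction, so
    -- at most `e j` collapses have been paid for, which is the exponent `h * e j + 1` (the `1` is
    -- the initial rounding of the final gaps).
    rcases hej.eq_or_lt with hej | hej
    · refine ⟨W, h1.merge, h2, hej ▸ h3, fun l hl hl' => ?_, h5, hej ▸ h6⟩
      rcases hl.eq_or_lt with rfl | hl
      exacts [rfl, (h4 l hl hl').trans hej]
    · obtain ⟨C, hC1, hC2, hC3⟩ := h1.merge.exists_reaches hF (h2.trans hn) h3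
      have hc := Multiset.card_eq_card_of_rel hC1
      rw [hS] at hc
      refine ⟨C, refines_of_rel hC1, by omega, rel_le_mem hC1 hr, ?_, ?_, hC2.trans ?_⟩
      · intro l h3 h4
        rw [show l = j by omega]
      · refine (good_of_reaches hC3 h2 h5).2 fun l hl hl' v hv => hok l v ?_
        rwa [h4 l (by omega) hl']
      · calc (1 + 1 / (F : ℝ)) ^ h * ((W.map (grid F)).sum : ℕ) ≤
              (1 + 1 / F) ^ h * ((1 + 1 / F) ^ (h * e (j + 1) + 1) *
                (((a + b) ::ₘ R).sum : ℕ)) := by gcongr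
          _ = (1 + 1 / F) ^ (h * (e (j + 1) + 1) + 1) * (((a + b) ::ₘ R).sum : ℕ) := by ring
          _ ≤ _ := by
            gcongr
            exact hej

/-- One more collapse handles the stage of the largest jobs and reduces everything to a single
class; hence `e 0 + 1` in the exponent. -/
theorem Splits.exists_good {F h n : ℕ} (hF : 0 < F) (hn : n ≤ 2 ^ h) (hn0 : 0 < n) {ρ e : ℕ → ℕ}
    (hρ : ∀ k, 1 ≤ ρ k) (hρm : Monotone ρ) (he : Antitone e) {ok : ℕ → ℕ → Prop}
    (hok : ∀ j v, ρ (e j) ≤ v → ok j v) {Z : ℕ} (hZ : ρ (e 0) ≤ Z)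
    (hS : Splits (fun j => ρ (e j)) (n - 1) {Z}) :
    ∃ D, Z ≤ grid F D ∧ Good (grid F) ok (n - 1) {D} ∧
      (grid F D : ℝ) ≤ (1 + 1 / F) ^ (h * (e 0 + 1) + 1) * Z := by
  obtain ⟨W, h1, h2, h3, h4, h5, h6⟩ := hS.exists_good_aux hF hn hρ hρm he hok (n - 1) {Z} 0
    (by simp) (by omega) (by simpa using hZ)
  obtain ⟨C, hC1, hC2, hC3⟩ := h1.exists_reaches hF (h2.trans hn) h3
  obtain ⟨D, C', hD, hC', rfl⟩ := Multiset.rel_cons_left.1 hC1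
  obtain rfl := Multiset.rel_zero_left.1 hC'
  refine ⟨D, hD, ?_, ?_⟩
  · refine (good_of_reaches hC3 h2 h5).2 fun l hl hl' v hv => hok l v ?_
    rwa [h4 l (by omega) hl']
  · have hC2' : (grid F D : ℝ) ≤ (1 + 1 / F) ^ h * ((W.map (grid F)).sum : ℕ) := by
      simpa using hC2
    refine hC2'.trans ?_
    calc (1 + 1 / (F : ℝ)) ^ h * ((W.map (grid F)).sum : ℕ) ≤
          (1 + 1 / F) ^ h * ((1 + 1 / F) ^ (h * e 0 + 1) * (({Z} : Multiset ℕ).sum : ℕ)) := by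
          gcongr
      _ = _ := by simp; ring

/-! ## From schedules to splits -/

/-- Here `γ i` is the length of the gap following job `i`. Two facts suffice: the gaps cover `[0,
Z)`, which provides a gap containing job `j`, and each gap ends at another job or at `Z`, so that
separation from that endpoint bounds the second part below. -/
theorem splits_of_separated_aux {n Z : ℕ} {z r : ℕ → ℕ}
    (hsep : ∀ i j, i < j → j < n → z i + r j ≤ z j ∨ z j + r j ≤ z i)
    (hend : ∀ i < n, z i + r i ≤ Z) (hr : ∀ i < n, 0 < r i) (m : ℕ) :
    ∀ j (γ : ℕ → ℕ), m + j = n → (∀ y < Z, ∃ i < j, z i ≤ y ∧ y < z i + γ i) →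
      (∀ i < j, z i + γ i = Z ∨ ∃ l < j, z i + γ i = z l) →
      Splits r m ((Multiset.range j).map γ) := by
  induction m with
  | zero => intros; trivial
  | succ m ih =>
    intro j γ hj hcov htight
    have hjn : j < n := by omega
    obtain ⟨i, hi, hi1, hi2⟩ := hcov (z j) (by have := hend j hjn; have := hr j hjn; omega)
    have ha : z i + r j ≤ z j := by
      have := hr j hjn
      rcases hsep i j hi hjn with h | h <;> omega
    have hb : z j + r j ≤ z i + γ i := by
      rcases htight i hi with h | ⟨l, hl, h⟩
      · rw [h]; exact hend j hjn
      · have := hr j hjn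
        rcases hsep l j hl hjn with h' | h' <;> omega
    have hne : ∀ l < j, l ≠ j := fun l hl => by omega
    have hrange : (Multiset.range j).map γ = γ i ::ₘ ((Multiset.range j).erase i).map γ := by
      rw [← Multiset.map_cons, Multiset.cons_erase (by simpa using hi)]
    refine ⟨z j - z i, z i + γ i - z j, ((Multiset.range j).erase i).map γ, ?_, ?_, ?_, ?_⟩
    · rw [hrange]; congr 1; omega
    · rw [Multiset.card_map, Multiset.card_range]; omega
    · rw [Multiset.card_map, Multiset.card_range]; omega
    · have := ih (j + 1) (Function.update (Function.update γ i (z j - z i)) j (z i + γ i - z j))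
        (by omega) ?_ ?_
      · convert this using 1
        rw [Multiset.range_succ, Multiset.map_cons, Function.update_self, Multiset.cons_swap]
        congr 1
        rw [← Multiset.cons_erase (show i ∈ Multiset.range j by simpa using hi),
          Multiset.map_cons, Function.update_of_ne (hne i hi), Function.update_self,
          Multiset.erase_cons_head]
        congr 1
        refine Multiset.map_congr rfl fun l hl => ?_
        rw [(Multiset.nodup_range j).mem_erase_iff, Multiset.mem_range] at hl
        rw [Function.update_of_ne (hne l hl.2), Function.update_of_ne hl.1]
      · intro y hy
        obtain ⟨l, hl, hl1, hl2⟩ := hcov y hy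
        by_cases hli : l = i
        · subst hli
          by_cases hyj : y < z j
          · refine ⟨l, by omega, hl1, ?_⟩
            rw [Function.update_of_ne (hne l hl), Function.update_self]; omega
          · refine ⟨j, by omega, by omega, ?_⟩
            rw [Function.update_self]; omega
        · refine ⟨l, by omega, hl1, ?_⟩
          rwa [Function.update_of_ne (hne l hl), Function.update_of_ne hli]
      · intro l hl
        by_cases hlj : l = j
        · subst hlj
          rw [Function.update_self, show z l + (z i + γ i - z l) = z i + γ i by omega]
          exact (htight i hi).imp_right fun ⟨l, hl, h⟩ => ⟨l, by omega, h⟩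
        · rw [Function.update_of_ne hlj]
          by_cases hli : l = i
          · subst hli
            rw [Function.update_self]
            exact .inr ⟨j, by omega, by omega⟩
          · rw [Function.update_of_ne hli]
            exact (htight l (by omega)).imp_right fun ⟨l, hl, h⟩ => ⟨l, by omega, h⟩

theorem splits_of_separated {n Z : ℕ} (hn : 0 < n) {z r : ℕ → ℕ} (h0 : z 0 = 0)
    (hsep : ∀ i j, i < j → j < n → z i + r j ≤ z j ∨ z j + r j ≤ z i)
    (hend : ∀ i < n, z i + r i ≤ Z) (hr : ∀ i < n, 0 < r i) : Splits r (n - 1) {Z} := by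
  have := splits_of_separated_aux hsep hend hr (n - 1) 1 (fun _ => Z) (by omega)
    (fun y hy => ⟨0, by omega, by omega, by omega⟩)
    (fun i hi => .inl (by rw [show i = 0 by omega, h0, zero_add]))
  simpa using this

/-! ## Rounding an arbitrary schedule -/

theorem Inst.init_arr_zero (I : Inst) (i : Fin I.n) : I.init.arr 0 i = I.p i := by
  simp [Inst.init]

theorem Inst.init_arr_antitone (I : Inst) : Antitone (I.init.arr 0) := by
  intro i j hij
  by_cases hj : j < I.n
  · have hi : i < I.n := by omega
    simp only [Inst.init, hi, hj, and_self, dite_true]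
    exact I.sorted hij
  · simp [Inst.init, hj]

theorem Inst.init_arr_pos (I : Inst) {j : ℕ} (hj : j < I.n) : 0 < I.init.arr 0 j := by
  simp only [Inst.init, hj, and_self, dite_true]
  exact I.pos _

/-- A schedule of makespan at most `M`, read on a circle of length `M`, can be rotated so that
the largest job comes first. -/
theorem Inst.Feasible.exists_rotation {I : Inst} {s : Fin I.n → ℝ} {M : ℝ} (hs : I.Feasible s)
    (hM : ∀ i, s i + I.p i ≤ M) (hn : 0 < I.n) : ∃ s' : Fin I.n → ℝ, (∀ i, 0 ≤ s' i) ∧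
      s' ⟨0, hn⟩ = 0 ∧ (∀ i, s' i + I.p i ≤ M) ∧
      ∀ i j, i ≠ j → s' i ≤ s' j → s' i + min (I.p i : ℝ) (I.p j : ℝ) ≤ s' j := by
  have key : ∀ i j, i ≠ j → s i ≤ s j → s i + min (I.p i : ℝ) (I.p j : ℝ) ≤ s j := by
    intro i j hij h
    have := hs.2 i j hij
    rw [abs_sub_comm, abs_of_nonneg (by linarith)] at this
    linarith
  set o : Fin I.n := ⟨0, hn⟩
  have ho : ∀ i, (I.p i : ℝ) ≤ I.p o := fun i => by
    exact_mod_cast I.sorted (Fin.mk_le_of_le_val (Nat.zero_le _))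
  have hlt : ∀ i, s i < s o → s i + I.p i ≤ s o := fun i hi => by
    have := key i o (by rintro rfl; exact lt_irrefl _ hi) hi.le
    rwa [min_eq_left (ho i)] at this
  -- Jobs before the largest job `o` move to the end of the circle. They still finish by `M`,
  -- because the distance from such a job to `o` is at least its own size.
  refine ⟨fun i => if s o ≤ s i then s i - s o else s i - s o + M, fun i => ?_, by simp,
    fun i => ?_, fun i j hij => ?_⟩
  · dsimp only
    split_ifs with h
    · linarith
    · have := hs.1 i
      have := hM o
      have : (0 : ℝ) ≤ I.p o := Nat.cast_nonneg _
      linarith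
  · dsimp only
    split_ifs with h
    · have := hs.1 o; have := hM i; linarith
    · have := hlt i (not_le.1 h); linarith
  · dsimp only
    have h1 := key i j hij
    have h3 := hs.1 i
    have h4 := hs.1 j
    have h5 := hM i
    have h6 := hM j
    have h7 := min_le_left (I.p i : ℝ) (I.p j)
    have h8 : (0 : ℝ) ≤ I.p i := Nat.cast_nonneg _
    have h9 : (0 : ℝ) < I.p j := Nat.cast_pos.2 (I.pos j)
    split_ifs with hi hj hj
    · intro h; linarith [h1 (by linarith)]
    · intro _; linarith
    · intro h; linarith
    · intro h; linarith [h1 (by linarith)]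

/-- The size of job `j` in units of `p 0 / (n * E)`, rounded up. -/
def Inst.units (I : Inst) (E j : ℕ) : ℕ :=
  (I.init.arr 0 j * (I.n * E) + (I.init.arr 0 0 - 1)) / I.init.arr 0 0

/-- The gap size `v`, in units of `p 0 / (n * E)`, is large enough for job `j`. -/
def Inst.Fits (I : Inst) (E j v : ℕ) : Prop :=
  I.init.arr 0 j * (I.n * E) ≤ v * I.init.arr 0 0

open Classical in
/-- The least grid element that is at least the size of job `j`. -/
noncomputable def Inst.level (I : Inst) (E j : ℕ) : ℕ :=
  Nat.find (p := fun k => I.units E j ≤ grid E k) ⟨_, (grid_strictMono E).le_apply⟩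

theorem Inst.units_le_grid (I : Inst) (E j : ℕ) : I.units E j ≤ grid E (I.level E j) := by
  classical
  exact Nat.find_spec (p := fun k => I.units E j ≤ grid E k) ⟨_, (grid_strictMono E).le_apply⟩

theorem Inst.level_le (I : Inst) {E j k : ℕ} (h : I.units E j ≤ grid E k) : I.level E j ≤ k := by
  classical
  exact Nat.find_min' _ h

theorem Inst.level_antitone (I : Inst) (E : ℕ) : Antitone (I.level E) := by
  intro i j hij
  refine I.level_le ((?_ : I.units E j ≤ I.units E i).trans (I.units_le_grid E i))
  have := I.init_arr_antitone hij
  unfold Inst.units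
  gcongr

theorem Inst.fits_of_level (I : Inst) {E j v : ℕ} (hn : 0 < I.n) (h : grid E (I.level E j) ≤ v) :
    I.Fits E j v := by
  have h0 := I.init_arr_pos hn
  have h1 := (I.units_le_grid E j).trans h
  unfold Inst.units at h1
  unfold Inst.Fits
  by_contra! hlt
  have h2 : v + 1 ≤ (I.init.arr 0 j * (I.n * E) + (I.init.arr 0 0 - 1)) / I.init.arr 0 0 := by
    rw [Nat.le_div_iff_mul_le h0, add_mul]
    omega
  omega

/-- The `+ 1` comes from rounding up to whole units, the factor `1 + 1 / E` from rounding up to the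
coarse grid. -/
theorem Inst.grid_level_le (I : Inst) {E j : ℕ} (hE : 0 < E) (hj : j < I.n) :
    (grid E (I.level E j) : ℝ) ≤ (1 + 1 / E) *
      (I.init.arr 0 j * (I.n * E) / I.init.arr 0 0 + 1) := by
  have hn : 0 < I.n := by omega
  have h0 := I.init_arr_pos hn
  have h1 : 1 ≤ I.units E j := by
    unfold Inst.units
    rw [Nat.le_div_iff_mul_le h0]
    have : 0 < I.init.arr 0 j * (I.n * E) :=
      Nat.mul_pos (I.init_arr_pos hj) (Nat.mul_pos hn hE)
    omega
  obtain ⟨k, hk, hk'⟩ := exists_grid_real hE h1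
  have h2 : (grid E (I.level E j) : ℝ) ≤ grid E k := by
    exact_mod_cast (grid_strictMono E).monotone (I.level_le hk)
  refine h2.trans (hk'.trans ?_)
  gcongr
  unfold Inst.units
  refine Nat.cast_div_le.trans ?_
  have h0' : (0 : ℝ) < I.init.arr 0 0 := by exact_mod_cast h0
  rw [div_add_one h0'.ne']
  gcongr
  push_cast [Nat.cast_sub (show 1 ≤ I.init.arr 0 0 from h0)]
  linarith

theorem Inst.units_zero (I : Inst) (E : ℕ) (hn : 0 < I.n) : I.units E 0 = I.n * E := by
  have h0 := I.init_arr_pos hn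
  unfold Inst.units
  rw [Nat.mul_add_div h0, Nat.div_eq_of_lt (by omega), add_zero]

/-- The precision `F` used for inputs with `n ≤ 2 ^ L`. -/
def precision (E L : ℕ) : ℕ := E * (L * (E * L + 1) + 1)

/-- With `precision E L = E * X` and exponent at most `X`, the power is at most `exp (1 / E)`. Here
`X` is the exponent of `Splits.exists_good` for depth `L` and top level `E * L`. -/
theorem one_add_precision_pow_le {E : ℕ} (hE : 0 < E) {L k : ℕ} (hk : k ≤ L * (E * L + 1) + 1) :
    (1 + 1 / (precision E L : ℝ)) ^ k ≤ 1 + 2 / E := by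
  set X := L * (E * L + 1) + 1
  have hE' : (1 : ℝ) ≤ E := by exact_mod_cast hE
  have hX : (0 : ℝ) < X := by positivity
  have hP : (precision E L : ℝ) = E * X := by simp [precision, X]
  have h1 : (1 : ℝ) ≤ 1 + 1 / (precision E L : ℝ) := by
    have : (0 : ℝ) ≤ 1 / (precision E L : ℝ) := by positivity
    linarith
  have h2 : 1 + 1 / (precision E L : ℝ) ≤ Real.exp (1 / (precision E L : ℝ)) := by
    rw [add_comm]; exact Real.add_one_le_exp _
  calc (1 + 1 / (precision E L : ℝ)) ^ k ≤ (1 + 1 / (precision E L : ℝ)) ^ X :=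
        pow_le_pow_right₀ h1 hk
    _ ≤ Real.exp (1 / (precision E L : ℝ)) ^ X := by gcongr
    _ = Real.exp (1 / E) := by
      rw [← Real.exp_nat_mul, hP]
      congr 1
      field_simp
    _ ≤ 1 + 2 / E := by
      have h3 : |1 / (E : ℝ)| ≤ 1 := by
        rw [abs_of_nonneg (by positivity), div_le_one (by linarith)]; exact hE'
      have h4 := Real.abs_exp_sub_one_le h3
      rw [abs_of_nonneg (show (0 : ℝ) ≤ 1 / E by positivity)] at h4
      have h5 := le_of_abs_le h4
      have : 2 * (1 / (E : ℝ)) = 2 / E := by ring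
      linarith

theorem Inst.exists_good (I : Inst) {E L : ℕ} (hn : 0 < I.n) (hE : 0 < E) (hL : I.n * E ≤ 2 ^ L)
    {s : Fin I.n → ℝ} {M : ℝ} (hs : I.Feasible s) (hM : ∀ i, s i + I.p i ≤ M) :
    ∃ D, I.n * E ≤ grid (precision E L) D ∧
      Good (grid (precision E L)) (I.Fits E) (I.n - 1) {D} ∧
      (grid (precision E L) D : ℝ) * (I.init.arr 0 0 / (I.n * E)) ≤ (1 + 11 / E) * M := by
  classical
  obtain ⟨s', hs0, hs1, hs2, hs3⟩ := hs.exists_rotation hM hn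
  have hp : ∀ i : Fin I.n, (I.p i : ℝ) = I.init.arr 0 i := fun i => by rw [I.init_arr_zero]
  set p := I.init.arr 0 with hpdef
  have hp0 : (0 : ℝ) < p 0 := by exact_mod_cast I.init_arr_pos hn
  have hE' : (1 : ℝ) ≤ E := by exact_mod_cast hE
  have hn' : (0 : ℝ) < I.n := by exact_mod_cast hn
  set u : ℝ := p 0 / (I.n * E) with hu
  have hu0 : 0 < u := by positivity
  set ρ : ℝ := 1 + 1 / E with hρ
  have hρ0 : 0 < ρ := by positivity
  have hM0 : p 0 ≤ M := by
    have := hs2 ⟨0, hn⟩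
    rw [hs1, hp] at this
    simpa using this
  have hr : ∀ j, j < I.n → (grid E (I.level E j) : ℝ) ≤ ρ * (p j / u + 1) := by
    intro j hj
    have := I.grid_level_le hE hj
    rwa [show (p j : ℝ) / u = p j * (I.n * E) / p 0 by rw [hu]; field_simp]
  let rk : Fin I.n → ℕ := fun i => (Finset.univ.filter fun l => s' l < s' i).card
  -- Stretching by `ρ` pays for rounding sizes to levels, and one extra unit per preceding job pays
  -- for rounding up to whole units. The `n` extra units amount to `p 0 / E`, hence at most `M / E`.
  let x : Fin I.n → ℝ := fun i => ρ * (s' i / u + rk i)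
  have hx0 : ∀ i, 0 ≤ x i := fun i => by have := hs0 i; positivity
  let z : ℕ → ℕ := fun j => if h : j < I.n then ⌊x ⟨j, h⟩⌋₊ else 0
  have hz : ∀ i : Fin I.n, z i = ⌊x i⌋₊ := fun i => by simp [z]
  let Z := ⌊ρ * (M / u + I.n)⌋₊
  have hstep : ∀ i j : Fin I.n, i ≠ j → s' i ≤ s' j →
      ∀ r : ℕ, (r : ℝ) ≤ ρ * (min (p i : ℝ) (p j) / u + 1) → z i + r ≤ z j := by
    intro i j hij hle r hr
    have h1 := hs3 i j hij hle
    rw [hp, hp] at h1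
    have hmin : (0 : ℝ) < min (p i : ℝ) (p j) := by
      rw [← hp, ← hp]
      exact lt_min (Nat.cast_pos.2 (I.pos i)) (Nat.cast_pos.2 (I.pos j))
    have h2 : rk i + 1 ≤ rk j := by
      refine Finset.card_lt_card (Finset.ssubset_iff_of_subset ?_ |>.2 ⟨i, ?_, ?_⟩)
      · intro l
        simp only [Finset.mem_filter, Finset.mem_univ, true_and]
        intro h; linarith
      · simp only [Finset.mem_filter, Finset.mem_univ, true_and]; linarith
      · simp
    have h2' : (rk i : ℝ) + 1 ≤ rk j := by exact_mod_cast h2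
    rw [hz, hz]
    -- Rounding starting times down preserves the distances, because the required distance `r` is an
    -- integer.
    refine Nat.le_floor ?_
    push_cast
    have h3 := Nat.floor_le (hx0 i)
    calc (⌊x i⌋₊ : ℝ) + r ≤ x i + ρ * (min (p i : ℝ) (p j) / u + 1) := add_le_add h3 hr
      _ = ρ * ((s' i + min (p i : ℝ) (p j)) / u + (rk i + 1)) := by simp only [x]; ring
      _ ≤ x j := by simp only [x]; gcongr
  have hsep : ∀ i j, i < j → j < I.n → z i + grid E (I.level E j) ≤ z j ∨
      z j + grid E (I.level E j) ≤ z i := by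
    intro i j hij hj
    have hi : i < I.n := by omega
    have hpij : (p j : ℝ) ≤ p i := by exact_mod_cast I.init_arr_antitone hij.le
    have hne : (⟨i, hi⟩ : Fin I.n) ≠ ⟨j, hj⟩ := by
      intro h; simp at h; omega
    rcases le_total (s' ⟨i, hi⟩) (s' ⟨j, hj⟩) with h | h
    · left
      refine hstep ⟨i, hi⟩ ⟨j, hj⟩ hne h _ ?_
      simpa [min_eq_right hpij] using hr j hj
    · right
      refine hstep ⟨j, hj⟩ ⟨i, hi⟩ hne.symm h _ ?_
      simpa [min_eq_left hpij] using hr j hj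
  have hend : ∀ i < I.n, z i + grid E (I.level E i) ≤ Z := by
    intro i hi
    have h1 := hs2 ⟨i, hi⟩
    rw [hp] at h1
    have h2 : rk ⟨i, hi⟩ + 1 ≤ I.n := by
      have : rk ⟨i, hi⟩ < (Finset.univ : Finset (Fin I.n)).card :=
        Finset.card_lt_card (Finset.filter_ssubset.2 ⟨⟨i, hi⟩, Finset.mem_univ _, lt_irrefl _⟩)
      simpa using this
    have h2' : (rk ⟨i, hi⟩ : ℝ) + 1 ≤ I.n := by exact_mod_cast h2
    refine Nat.le_floor ?_
    have h3 := Nat.floor_le (hx0 ⟨i, hi⟩)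
    have h4 := hr i hi
    have h5 : z i = ⌊x ⟨i, hi⟩⌋₊ := hz ⟨i, hi⟩
    push_cast
    rw [h5]
    calc (⌊x ⟨i, hi⟩⌋₊ : ℝ) + grid E (I.level E i) ≤ x ⟨i, hi⟩ + ρ * (p i / u + 1) :=
          add_le_add h3 h4
      _ = ρ * ((s' ⟨i, hi⟩ + p i) / u + (rk ⟨i, hi⟩ + 1)) := by simp only [x]; ring
      _ ≤ ρ * (M / u + I.n) := by gcongr
  have hz0 : z 0 = 0 := by
    have h1 : rk ⟨0, hn⟩ = 0 := by
      refine Finset.card_eq_zero.2 (Finset.filter_eq_empty_iff.2 fun l _ => ?_)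
      rw [hs1]
      exact not_lt.2 (hs0 l)
    have h2 : z 0 = ⌊x ⟨0, hn⟩⌋₊ := hz ⟨0, hn⟩
    rw [h2]
    simp [x, h1, hs1]
  have hn2 : I.n ≤ 2 ^ L := (Nat.le_mul_of_pos_right _ hE).trans hL
  have hF : 0 < precision E L := by unfold precision; positivity
  obtain ⟨D, hD1, hD2, hD3⟩ := (splits_of_separated hn hz0 hsep hend
    fun i _ => grid_pos _ _).exists_good hF hn2 hn (grid_pos E) (grid_strictMono E).monotone
      (I.level_antitone E) (ok := I.Fits E) (fun j v hv => I.fits_of_level hn hv)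
      (by have := hend 0 hn; omega)
  refine ⟨D, ?_, hD2, ?_⟩
  · have h1 := I.units_le_grid E 0
    rw [I.units_zero E hn] at h1
    have := hend 0 hn
    omega
  · have hlev : I.level E 0 ≤ E * L := by
      refine I.level_le ?_
      rw [I.units_zero E hn]
      exact hL.trans (two_pow_le_grid hE L)
    have hpow : (1 + 1 / (precision E L : ℝ)) ^ (L * (I.level E 0 + 1) + 1) ≤ 1 + 2 / E :=
      one_add_precision_pow_le hE (by gcongr)
    have hM' : 0 ≤ M := hp0.le.trans hM0
    have hZ : (Z : ℝ) ≤ ρ * (M / u + I.n) := Nat.floor_le (by positivity)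
    have hun : u * I.n = p 0 / E := by rw [hu]; field_simp
    have hy : (0 : ℝ) ≤ 1 / E := by positivity
    have hy1 : 1 / (E : ℝ) ≤ 1 := by rw [div_le_one (by linarith)]; exact hE'
    calc (grid (precision E L) D : ℝ) * u ≤ (1 + 2 / E) * (ρ * (M / u + I.n)) * u := by
          gcongr
          exact hD3.trans (by gcongr)
      _ = (1 + 2 / E) * ρ * (M + u * I.n) := by field_simp
      _ ≤ (1 + 2 / E) * ρ * (M + M / E) := by rw [hun]; gcongr
      -- Expanding `(1 + 2y)(1 + y)²` with `y = 1 / E ≤ 1`; the coefficients `4 + 5 + 2` give the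
      -- constant 11.
      _ = (1 + 4 * (1 / E) + 5 * (1 / E : ℝ) ^ 2 + 2 * (1 / E : ℝ) ^ 3) * M := by
          rw [hρ]; ring
      _ ≤ (1 + 11 * (1 / E)) * M := by
          refine mul_le_mul_of_nonneg_right ?_ hM'
          generalize 1 / (E : ℝ) = y at hy hy1
          have h2 : y ^ 2 ≤ y := by nlinarith
          have h3 : y ^ 3 ≤ y := by nlinarith
          linarith
      _ = (1 + 11 / E) * M := by ring

/-! ## Coding multisets of gaps by numbers -/

/-- The number whose base `B` digits count the elements of `W`. -/
def code (B : ℕ) (W : Multiset ℕ) : ℕ := (W.map fun c => B ^ c).sum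

theorem code_cons (B c : ℕ) (W : Multiset ℕ) : code B (c ::ₘ W) = B ^ c + code B W := by
  simp [code]

theorem code_add (B : ℕ) (V W : Multiset ℕ) : code B (V + W) = code B V + code B W := by
  simp [code]

theorem code_lt {B K : ℕ} {W : Multiset ℕ} (hW : ∀ c ∈ W, c < K) (hB : Multiset.card W < B) :
    code B W < B ^ K := by
  rcases K with _ | K
  · have : W = 0 := Multiset.eq_zero_of_forall_notMem fun c hc => by simpa using hW c hc
    simp [this, code]
  · have h1 : code B W ≤ Multiset.card (W.map fun c => B ^ c) • B ^ K := by
      refine Multiset.sum_le_card_nsmul _ _ fun x hx => ?_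
      obtain ⟨c, hc, rfl⟩ := Multiset.mem_map.1 hx
      exact Nat.pow_le_pow_right (by omega) (Nat.lt_succ_iff.1 (hW c hc))
    rw [Multiset.card_map, smul_eq_mul] at h1
    rw [pow_succ, mul_comm]
    exact h1.trans_lt (Nat.mul_lt_mul_of_pos_right hB (Nat.pow_pos (by omega)))

/-- Elements below `c` contribute less than `B ^ c` in total, elements above `c` a multiple of `B ^
(c + 1)`; having fewer than `B` elements excludes carries. -/
theorem code_div_mod {B : ℕ} {W : Multiset ℕ} (hB : Multiset.card W < B) (c : ℕ) :
    code B W / B ^ c % B = W.count c := by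
  have hB0 : 0 < B := by omega
  have h1 : W = W.filter (· < c) + (Multiset.replicate (W.count c) c + W.filter (c < ·)) := by
    conv_lhs => rw [← Multiset.filter_add_not (· < c) W]
    congr 1
    rw [← Multiset.filter_add_not (c = ·) (Multiset.filter _ W), Multiset.filter_filter,
      Multiset.filter_filter]
    congr 1
    · rw [← Multiset.filter_eq]
      exact Multiset.filter_congr fun x _ => by omega
    · exact Multiset.filter_congr fun x _ => by omega
  have hlow : code B (W.filter (· < c)) < B ^ c :=
    code_lt (fun x hx => (Multiset.mem_filter.1 hx).2)
      ((Multiset.card_le_card (Multiset.filter_le _ _)).trans_lt hB)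
  have hhigh : B ^ (c + 1) ∣ code B (W.filter (c < ·)) := by
    refine Multiset.dvd_sum fun x hx => ?_
    obtain ⟨y, hy, rfl⟩ := Multiset.mem_map.1 hx
    exact pow_dvd_pow _ (Multiset.mem_filter.1 hy).2
  obtain ⟨q, hq⟩ := hhigh
  have hmid : code B (Multiset.replicate (W.count c) c) = W.count c * B ^ c := by
    simp [code]
  have hcode : code B W = code B (W.filter (· < c)) + B ^ c * (W.count c + B * q) := by
    conv_lhs => rw [h1]
    rw [code_add, code_add, hmid, hq]
    ring
  rw [hcode, Nat.add_mul_div_left _ _ (by positivity), Nat.div_eq_of_lt hlow, zero_add,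
    Nat.add_mul_mod_self_left, Nat.mod_eq_of_lt ((Multiset.count_le_card c W).trans_lt hB)]

theorem code_div_mod_ne_zero {B : ℕ} {W : Multiset ℕ} (hB : Multiset.card W < B) {c : ℕ} :
    code B W / B ^ c % B ≠ 0 ↔ c ∈ W := by
  rw [code_div_mod hB, Multiset.count_ne_zero]

/-! ## The dynamic program -/

/-- The code after splitting a gap according to `d`, which codes three classes in base `K`. -/
def nextCode (n K x d : ℕ) : ℕ :=
  x + (n + 1) ^ (d % K) + (n + 1) ^ (d / K % K) - (n + 1) ^ (d / (K * K))

/-- With `m` jobs remaining afterwards, the split coded by `d` is allowed at the code `x`. -/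
def ValidSplit (n K : ℕ) (g : ℕ → ℕ) (ok : ℕ → ℕ → Prop) (m x d : ℕ) : Prop :=
  g (d % K) + g (d / K % K) ≤ g (d / (K * K)) ∧ ok (n - 1 - m) (g (d % K)) ∧
    ok (n - 1 - m) (g (d / K % K)) ∧ x / (n + 1) ^ (d / (K * K)) % (n + 1) ≠ 0 ∧
    nextCode n K x d < (n + 1) ^ K

/-- The last `m` jobs can be inserted into the gaps coded by `x`. -/
def Solvable (n K : ℕ) (g : ℕ → ℕ) (ok : ℕ → ℕ → Prop) : ℕ → ℕ → Prop
  | 0, _ => True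
  | m + 1, x => ∃ d < K * K * K, ValidSplit n K g ok m x d ∧
      Solvable n K g ok m (nextCode n K x d)

theorem triple_decode {K a b c : ℕ} (ha : a < K) (hb : b < K) (hc : c < K) :
    a + K * (b + K * c) < K * K * K ∧ (a + K * (b + K * c)) % K = a ∧
      (a + K * (b + K * c)) / K % K = b ∧ (a + K * (b + K * c)) / (K * K) = c := by
  have hK : 0 < K := by omega
  have h1 : (a + K * (b + K * c)) / K = b + K * c := by
    rw [Nat.add_mul_div_left _ _ hK, Nat.div_eq_of_lt ha, zero_add]
  refine ⟨?_, ?_, ?_, ?_⟩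
  · have h2 : b + K * c + 1 ≤ K * K := by nlinarith
    nlinarith
  · rw [Nat.add_mul_mod_self_left, Nat.mod_eq_of_lt ha]
  · rw [h1, Nat.add_mul_mod_self_left, Nat.mod_eq_of_lt hb]
  · rw [← Nat.div_div_eq_div_mul, h1, Nat.add_mul_div_left _ _ hK, Nat.div_eq_of_lt hb, zero_add]

theorem triple_lt {K d : ℕ} (hd : d < K * K * K) : d % K < K ∧ d / K % K < K ∧
    d / (K * K) < K := by
  have hK : 0 < K := Nat.pos_of_ne_zero fun h => by simp [h] at hd
  exact ⟨Nat.mod_lt _ hK, Nat.mod_lt _ hK, Nat.div_lt_of_lt_mul hd⟩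

/-- Both parts of a split have positive size, so their classes are smaller than that of the gap, and
all classes stay below `K`. -/
theorem solvable_of_good {n K : ℕ} {g : ℕ → ℕ} {ok : ℕ → ℕ → Prop} (hg : StrictMono g)
    (hg0 : ∀ k, 0 < g k) (m : ℕ) : ∀ W : Multiset ℕ, Good g ok m W → (∀ c ∈ W, c < K) →
      m + Multiset.card W = n → Solvable n K g ok m (code (n + 1) W) := by
  induction m with
  | zero => intros; trivial
  | succ m ih =>
    rintro W ⟨a, b, c, R, rfl, h1, h2, h3, h4⟩ hK hm
    rw [Multiset.card_cons] at hm h2 h3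
    have hc : c < K := hK c (Multiset.mem_cons_self c R)
    have ha : a < K := lt_trans (hg.lt_iff_lt.1 (by have := hg0 b; omega)) hc
    have hb : b < K := lt_trans (hg.lt_iff_lt.1 (by have := hg0 a; omega)) hc
    obtain ⟨hd, hda, hdb, hdc⟩ := triple_decode ha hb hc
    have hnext : nextCode n K (code (n + 1) (c ::ₘ R)) (a + K * (b + K * c)) =
        code (n + 1) (a ::ₘ b ::ₘ R) := by
      simp only [nextCode, hda, hdb, hdc, code_cons]
      omega
    have hK' : ∀ x ∈ a ::ₘ b ::ₘ R, x < K := by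
      intro x hx
      simp only [Multiset.mem_cons] at hx
      rcases hx with rfl | rfl | hx
      exacts [ha, hb, hK x (Multiset.mem_cons_of_mem hx)]
    refine ⟨a + K * (b + K * c), hd, ?_, ?_⟩
    · rw [ValidSplit, hnext, hda, hdb, hdc]
      have hj : n - 1 - m = Multiset.card R + 1 := by omega
      rw [hj]
      refine ⟨h1, h2, h3, ?_, ?_⟩
      · rw [code_div_mod_ne_zero (by rw [Multiset.card_cons]; omega)]
        exact Multiset.mem_cons_self c R
      · exact code_lt hK' (by simp only [Multiset.card_cons]; omega)
    · rw [hnext]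
      exact ih _ h4 hK' (by simp only [Multiset.card_cons]; omega)

/-! ## Building the schedule -/

/-- Jobs `0, ..., j - 1` are placed at the positions `pos` (in units of `p 0 / (n * E)`), each
followed by a gap of class `cls`, in a total length `Z`. -/
structure Inst.Placed (I : Inst) (E : ℕ) (g : ℕ → ℕ) (Z j : ℕ) (cls pos : ℕ → ℕ) : Prop where
  disj : ∀ i < j, ∀ l < j, i ≠ l → pos i + g (cls i) ≤ pos l ∨ pos l + g (cls l) ≤ pos i
  inside : ∀ i < j, pos i + g (cls i) ≤ Z
  makespan : ∀ i < j, pos i * I.init.arr 0 0 + I.init.arr 0 i * (I.n * E) ≤ Z * I.init.arr 0 0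
  sep : ∀ i < j, ∀ l < i,
    pos i * I.init.arr 0 0 + I.init.arr 0 i * (I.n * E) ≤ pos l * I.init.arr 0 0 ∨
    pos l * I.init.arr 0 0 + I.init.arr 0 i * (I.n * E) ≤ pos i * I.init.arr 0 0

/-- The new job goes at distance `g a` behind job `i`. Other jobs lie outside the old gap of `i`, so
they are separated from the new one by at least one of the two parts; `Fits` turns both parts into
sufficient distances. -/
theorem Inst.Placed.insert {I : Inst} {E Z j i a b : ℕ} {g cls pos : ℕ → ℕ}
    (h : I.Placed E g Z j cls pos) (hi : i < j) (hab : g a + g b ≤ g (cls i))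
    (ha : I.Fits E j (g a)) (hb : I.Fits E j (g b)) :
    I.Placed E g Z (j + 1) (Function.update (Function.update cls i a) j b)
      (Function.update pos j (pos i + g a)) := by
  have hne : ∀ l < j, l ≠ j := fun l hl => hl.ne
  have hpos : ∀ l < j, Function.update pos j (pos i + g a) l = pos l := fun l hl => by
    rw [Function.update_of_ne (hne l hl)]
  have hcls : ∀ l < j, g (Function.update (Function.update cls i a) j b l) ≤ g (cls l) ∧
      (l = i → g (Function.update (Function.update cls i a) j b l) = g a) := fun l hl => by
    rw [Function.update_of_ne (hne l hl)]
    by_cases hli : l = i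
    · subst hli; simp; omega
    · simp [hli]
  have hnew : ∀ l < j, pos i + g a + g b ≤ pos l ∨
      pos l + g (Function.update (Function.update cls i a) j b l) ≤ pos i + g a := by
    intro l hl
    by_cases hli : l = i
    · right; rw [(hcls l hl).2 hli, hli]
    · have := (hcls l hl).1
      rcases h.disj i hi l hl (Ne.symm hli) with h1 | h1
      · left; omega
      · right; omega
  have hjj : pos i + g a + g b ≤ Z := by have := h.inside i hi; omega
  unfold Inst.Fits at ha hb
  have hlt : ∀ {l}, l < j + 1 → l ≠ j → l < j := by intros; omega
  refine ⟨fun x hx l hl hxl => ?_, fun x hx => ?_, fun x hx => ?_, fun x hx l hl => ?_⟩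
  · by_cases hxj : x = j
    · subst hxj
      rw [hpos l (hlt hl hxl.symm), Function.update_self, Function.update_self]
      exact hnew l (hlt hl hxl.symm)
    · by_cases hlj : l = j
      · subst hlj
        rw [hpos x (hlt hx hxl), Function.update_self, Function.update_self]
        exact (hnew x (hlt hx hxl)).symm
      · rw [hpos x (hlt hx hxj), hpos l (hlt hl hlj)]
        have h1 := (hcls x (hlt hx hxj)).1
        have h2 := (hcls l (hlt hl hlj)).1
        rcases h.disj x (hlt hx hxj) l (hlt hl hlj) hxl with h3 | h3
        · left; omega
        · right; omega
  · by_cases hxj : x = j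
    · subst hxj; simpa using hjj
    · rw [hpos x (hlt hx hxj)]
      have h1 := (hcls x (hlt hx hxj)).1
      have h2 := h.inside x (hlt hx hxj)
      omega
  · by_cases hxj : x = j
    · subst hxj
      rw [Function.update_self]
      have := Nat.mul_le_mul_right (I.init.arr 0 0) hjj
      rw [add_mul] at this
      omega
    · rw [hpos x (hlt hx hxj)]
      exact h.makespan x (hlt hx hxj)
  · by_cases hxj : x = j
    · subst hxj
      rw [hpos l hl, Function.update_self]
      by_cases hli : l = i
      · right; rw [hli, add_mul]; omega
      · rcases h.disj i hi l hl (Ne.symm hli) with h1 | h1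
        · left
          have h2 := Nat.mul_le_mul_right (I.init.arr 0 0)
            (show pos i + g a + g b ≤ pos l by omega)
          rw [add_mul] at h2
          omega
        · right
          have h2 := Nat.mul_le_mul_right (I.init.arr 0 0)
            (show pos l + g a ≤ pos i + g a by omega)
          rw [add_mul] at h2
          omega
    · have hxj' := hlt hx hxj
      rw [hpos x hxj', hpos l (by omega)]
      exact h.sep x hxj' l hl

/-! ## The program -/

namespace AExp

instance : Add AExp := ⟨add⟩
instance : Sub AExp := ⟨sub⟩
instance : Mul AExp := ⟨mul⟩
instance : Div AExp := ⟨div⟩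

@[simp] theorem val_const (σ : State) (k : ℕ) : (const k).val σ = k := rfl
@[simp] theorem val_reg (σ : State) (x : ℕ) : (reg x).val σ = σ.reg x := rfl
@[simp] theorem val_load (σ : State) (a : ℕ) (i : AExp) :
    (load a i).val σ = σ.arr a (i.val σ) := rfl
@[simp] theorem val_add (σ : State) (e f : AExp) : (e + f).val σ = e.val σ + f.val σ := rfl
@[simp] theorem val_sub (σ : State) (e f : AExp) : (e - f).val σ = e.val σ - f.val σ := rfl
@[simp] theorem val_mul (σ : State) (e f : AExp) : (e * f).val σ = e.val σ * f.val σ := rfl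
@[simp] theorem val_div (σ : State) (e f : AExp) : (e / f).val σ = e.val σ / f.val σ := rfl

/-- Remainder. -/
def mod (e f : AExp) : AExp := e - e / f * f

@[simp] theorem val_mod (σ : State) (e f : AExp) : (mod e f).val σ = e.val σ % f.val σ :=
  (Nat.mod_eq_sub_div_mul).symm

/-- The test `e ≤ f`. -/
def le (e f : AExp) : AExp := const 1 - (e - f)

theorem val_le_ne_zero (σ : State) (e f : AExp) : (le e f).val σ ≠ 0 ↔ e.val σ ≤ f.val σ := by
  simp only [le, val_sub, val_const]; omega

/-- The test `e = f`. -/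
def eq (e f : AExp) : AExp := const 1 - ((e - f) + (f - e))

theorem val_eq_ne_zero (σ : State) (e f : AExp) : (eq e f).val σ ≠ 0 ↔ e.val σ = f.val σ := by
  simp only [eq, val_sub, val_const, val_add]; omega

end AExp

@[simp] theorem State.setReg_reg (σ : State) (x v y : ℕ) :
    (σ.setReg x v).reg y = if y = x then v else σ.reg y := by
  simp [State.setReg, Function.update_apply]

@[simp] theorem State.setReg_arr (σ : State) (x v : ℕ) : (σ.setReg x v).arr = σ.arr := rfl

@[simp] theorem State.setArr_reg (σ : State) (a i v : ℕ) : (σ.setArr a i v).reg = σ.reg := rfl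

@[simp] theorem State.setArr_arr (σ : State) (a i v b : ℕ) :
    (σ.setArr a i v).arr b = if b = a then Function.update (σ.arr a) i v else σ.arr b := by
  by_cases h : b = a
  · subst h; simp [State.setArr]
  · simp [State.setArr, h]

open AExp Prog

/-! Registers: 0 `n`; 1 a power of two; 2 `L`; 3 `F`; 4 `K`; 5 a counter; 6 a grid element;
7 a power of `n + 1`, finally `(n + 1) ^ K`; 8 the counter of the dynamic program; 9 the class of
the total length; 10 the current code; 11 the current job; 12 the gap under consideration; 13 the
chosen split. Arrays: 0 `p`; 1 the output; 2 the grid; 3 the powers of `n + 1`; 4 the table of the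
dynamic program; 5 the classes of the gaps; 6 the positions. -/

/-- An optimal schedule has at most `E * n²` units and the approximation factor is at most 12, so a
grid reaching `16 * E * n²` contains every length that is needed. -/
def logTest (E : ℕ) : AExp := const (16 * E) * (reg 0 * reg 0) - reg 1

def logBody : Prog := seq (assign 1 (reg 1 * const 2)) (assign 2 (reg 2 + const 1))

def paramCode (E : ℕ) : Prog :=
  seq (assign 3 (const E * (reg 2 * (const E * reg 2 + const 1) + const 1)))
    (seq (assign 4 (reg 3 * reg 2)) (seq (assign 6 (const 1)) (assign 7 (const 1))))

def gridBody : Prog :=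
  seq (store 2 (reg 5) (reg 6)) (seq (store 3 (reg 5) (reg 7))
    (seq (assign 6 (reg 6 + const 1 + reg 6 / reg 3))
      (seq (assign 7 (reg 7 * (reg 0 + const 1))) (assign 5 (reg 5 + const 1)))))

/-- The classes of the two parts and of the gap in the split coded by `d`. -/
def fstClass (d : AExp) : AExp := mod d (reg 4)
def sndClass (d : AExp) : AExp := mod (d / reg 4) (reg 4)
def gapClass (d : AExp) : AExp := d / (reg 4 * reg 4)

def nextExp (x d : AExp) : AExp :=
  x + load 3 (fstClass d) + load 3 (sndClass d) - load 3 (gapClass d)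

def fitsExp (E : ℕ) (j v : AExp) : AExp :=
  le (load 0 j * (reg 0 * const E)) (v * load 0 (const 0))

def validExp (E : ℕ) (m x d : AExp) : AExp :=
  le (load 2 (fstClass d) + load 2 (sndClass d)) (load 2 (gapClass d)) *
    (fitsExp E (reg 0 - const 1 - m) (load 2 (fstClass d)) *
      (fitsExp E (reg 0 - const 1 - m) (load 2 (sndClass d)) *
        (mod (x / load 3 (gapClass d)) (reg 0 + const 1) * (reg 7 - nextExp x d))))

/-- The row for `m` remaining jobs is stored with index `m - 1`. With no job remaining, the summand
`1 - m` makes the value nonzero whatever the truncated index reads. -/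
def lookupExp (m x : AExp) : AExp :=
  load 4 ((m - const 1) * reg 7 + x) + (const 1 - m)

def cubeExp : AExp := reg 4 * reg 4 * reg 4

def dpTest : AExp := (reg 0 - const 1) * reg 7 * cubeExp - reg 8

/-- The counter in register 8 is read as `(m * codes + y) * triples + d`: rows in order of remaining
jobs, then codes, then splits. Entries store `d + 1`, so that zero means unsolved. -/
def dpCond (E : ℕ) : AExp :=
  validExp E (reg 8 / cubeExp / reg 7) (mod (reg 8 / cubeExp) (reg 7)) (mod (reg 8) cubeExp) *
    lookupExp (reg 8 / cubeExp / reg 7)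
      (nextExp (mod (reg 8 / cubeExp) (reg 7)) (mod (reg 8) cubeExp))

def dpBody (E : ℕ) : Prog :=
  seq (ite (dpCond E) (store 4 (reg 8 / cubeExp) (mod (reg 8) cubeExp + const 1)) skip)
    (assign 8 (reg 8 + const 1))

def lengthTest (E : ℕ) : AExp :=
  const 1 - lookupExp (reg 0 - const 1) (load 3 (reg 9)) *
    le (reg 0 * const E) (load 2 (reg 9))

def lengthBody : Prog := assign 9 (reg 9 + const 1)

def startCode : Prog :=
  seq (store 5 (const 0) (reg 9)) (seq (assign 10 (load 3 (reg 9))) (assign 11 (const 1)))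

def buildTest : AExp := reg 0 - reg 11

def insertCode (E : ℕ) : Prog :=
  seq (store 6 (reg 11) (load 6 (reg 12) + load 2 (fstClass (reg 13))))
    (seq (store 1 (reg 11) (load 6 (reg 11) * load 0 (const 0) / (reg 0 * const E)))
      (seq (store 5 (reg 12) (fstClass (reg 13)))
        (seq (store 5 (reg 11) (sndClass (reg 13)))
          (seq (assign 10 (nextExp (reg 10) (reg 13)))
            (seq (assign 11 (reg 11 + const 1)) (assign 12 (const 0)))))))

/-- The code only tells which class of gap to split; a linear scan over the placed jobs finds a
concrete gap of that class. -/
def buildBody (E : ℕ) : Prog :=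
  seq (assign 13 (load 4 ((reg 0 - const 1 - reg 11) * reg 7 + reg 10) - const 1))
    (ite (eq (load 5 (reg 12)) (gapClass (reg 13))) (insertCode E)
      (assign 12 (reg 12 + const 1)))

/-- The approximation scheme with precision parameter `E`. -/
def scheme (E : ℕ) : Prog :=
  ite (reg 0)
    (seq (assign 1 (const 1)) (seq (loop (logTest E) logBody)
      (seq (paramCode E) (seq (loop (reg 4 - reg 5) gridBody)
        (seq (loop dpTest (dpBody E)) (seq (loop (lengthTest E) lengthBody)
          (seq startCode (loop buildTest (buildBody E)))))))))
    skip

/-! ## Parameters -/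

def Inst.logSize (I : Inst) (E : ℕ) : ℕ := Nat.clog 2 (16 * E * (I.n * I.n))

def Inst.prec (I : Inst) (E : ℕ) : ℕ := precision E (I.logSize E)

/-- The number of gap classes. -/
def Inst.classes (I : Inst) (E : ℕ) : ℕ := I.prec E * I.logSize E

/-- All codes are less than this number. -/
def Inst.codes (I : Inst) (E : ℕ) : ℕ := (I.n + 1) ^ I.classes E

/-- The number of triples of classes. -/
def Inst.triples (I : Inst) (E : ℕ) : ℕ := I.classes E * I.classes E * I.classes E

/-- `M` bounds all numbers that occur. -/
structure Inst.Bound (I : Inst) (E M : ℕ) : Prop where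
  p : ∀ j, I.init.arr 0 j ≤ M
  n : I.n ≤ M
  two_pow : 2 ^ I.logSize E ≤ M
  prec : I.prec E ≤ M
  classes : I.classes E ≤ M
  grid : ∀ k ≤ I.classes E, grid (I.prec E) k ≤ M
  out : ∀ k ≤ I.classes E, TriangleScheduling.grid (I.prec E) k * I.init.arr 0 0 ≤ M
  codes : I.codes E ≤ M
  triples : I.triples E ≤ M
  time : (I.n - 1) * I.codes E * I.triples E ≤ M

def Inst.Solv (I : Inst) (E : ℕ) : ℕ → ℕ → Prop :=
  Solvable I.n (I.classes E) (grid (I.prec E)) (I.Fits E)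

/-- The split `d` starts a solution. -/
def Inst.Choice (I : Inst) (E m x d : ℕ) : Prop :=
  d < I.triples E ∧ ValidSplit I.n (I.classes E) (grid (I.prec E)) (I.Fits E) m x d ∧
    I.Solv E m (nextCode I.n (I.classes E) x d)

/-- What the program keeps fixed once the grid has been computed. -/
structure Inst.Tables (I : Inst) (E M : ℕ) (σ : State) : Prop where
  bdd : σ.Bdd M
  reg0 : σ.reg 0 = I.n
  reg4 : σ.reg 4 = I.classes E
  reg7 : σ.reg 7 = I.codes E
  arr0 : σ.arr 0 = I.init.arr 0
  arr2 : ∀ k < I.classes E, σ.arr 2 k = grid (I.prec E) k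
  arr3 : ∀ k < I.classes E, σ.arr 3 k = (I.n + 1) ^ k

theorem Inst.Tables.val_cube {I : Inst} {E M : ℕ} {σ : State} (h : I.Tables E M σ) :
    cubeExp.val σ = I.triples E := by
  simp [cubeExp, h.reg4, Inst.triples]

theorem Inst.Tables.val_next {I : Inst} {E M : ℕ} {σ : State} (h : I.Tables E M σ) {x d : AExp}
    (hd : d.val σ < I.triples E) :
    (nextExp x d).val σ = nextCode I.n (I.classes E) (x.val σ) (d.val σ) := by
  obtain ⟨h1, h2, h3⟩ := triple_lt hd
  simp [nextExp, nextCode, fstClass, sndClass, gapClass, h.reg4, h.arr3 _ h1, h.arr3 _ h2,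
    h.arr3 _ h3]

theorem Inst.Tables.val_fits {I : Inst} {E M : ℕ} {σ : State} (h : I.Tables E M σ) (j v : AExp) :
    (fitsExp E j v).val σ ≠ 0 ↔ I.Fits E (j.val σ) (v.val σ) := by
  simp [fitsExp, val_le_ne_zero, Inst.Fits, h.reg0, h.arr0]

theorem Inst.Tables.val_valid {I : Inst} {E M : ℕ} {σ : State} (h : I.Tables E M σ)
    {m x d : AExp} (hd : d.val σ < I.triples E) :
    (validExp E m x d).val σ ≠ 0 ↔ ValidSplit I.n (I.classes E) (grid (I.prec E)) (I.Fits E)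
      (m.val σ) (x.val σ) (d.val σ) := by
  obtain ⟨h1, h2, h3⟩ := triple_lt hd
  unfold validExp ValidSplit
  simp only [val_mul, mul_ne_zero_iff, val_le_ne_zero, h.val_fits, val_sub, h.val_next hd]
  simp only [fstClass, sndClass, gapClass, val_add, val_load, val_mod, val_div, val_reg, val_mul,
    val_const, h.reg0, h.reg4, h.reg7, h.arr2 _ h1, h.arr2 _ h2, h.arr2 _ h3, h.arr3 _ h3]
  have h4 : ∀ a b : ℕ, a - b ≠ 0 ↔ b < a := fun a b => by omega
  rw [h4]
  rfl

/-- The table `T` of the dynamic program after `t` steps. -/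
structure Inst.TableInv (I : Inst) (E t : ℕ) (T : ℕ → ℕ) : Prop where
  sound : ∀ x, T x ≠ 0 → I.Choice E (x / I.codes E) (x % I.codes E) (T x - 1)
  complete : ∀ x d, x * I.triples E + d < t →
    I.Choice E (x / I.codes E) (x % I.codes E) d → T x ≠ 0

theorem Inst.codes_pos (I : Inst) (E : ℕ) : 0 < I.codes E := Nat.pow_pos (Nat.succ_pos _)

/-- The hypothesis on `t` says that row `m` has been completely processed, so a zero entry there is
a proof of unsolvability. -/
theorem Inst.TableInv.entry {I : Inst} {E t : ℕ} {T : ℕ → ℕ} (h : I.TableInv E t T) {m y : ℕ}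
    (hm : (m + 1) * I.codes E * I.triples E ≤ t) (hy : y < I.codes E) :
    (T (m * I.codes E + y) ≠ 0 ↔ I.Solv E (m + 1) y) ∧
      (T (m * I.codes E + y) ≠ 0 → I.Choice E m y (T (m * I.codes E + y) - 1)) := by
  have hc := I.codes_pos E
  have h1 : (m * I.codes E + y) / I.codes E = m := by
    rw [mul_comm, Nat.mul_add_div hc, Nat.div_eq_of_lt hy, add_zero]
  have h2 : (m * I.codes E + y) % I.codes E = y := by
    rw [mul_comm, Nat.mul_add_mod, Nat.mod_eq_of_lt hy]
  have h3 := h.sound (m * I.codes E + y)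
  rw [h1, h2] at h3
  refine ⟨⟨fun hT => ⟨_, h3 hT⟩, ?_⟩, h3⟩
  rintro ⟨d, hd, hd1, hd2⟩
  refine h.complete _ d ?_ (by rw [h1, h2]; exact ⟨hd, hd1, hd2⟩)
  have h4 : m * I.codes E + y + 1 ≤ (m + 1) * I.codes E := by rw [add_mul]; omega
  have h5 := Nat.mul_le_mul_right (I.triples E) h4
  rw [add_mul (_ + _)] at h5
  have hd' : d < I.triples E := hd
  omega

theorem Inst.TableInv.lookup {I : Inst} {E M t : ℕ} {σ : State} (hσ : I.Tables E M σ)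
    (h : I.TableInv E t (σ.arr 4)) {m x : AExp}
    (hm : m.val σ * I.codes E * I.triples E ≤ t) (hx : x.val σ < I.codes E) :
    (lookupExp m x).val σ ≠ 0 ↔ I.Solv E (m.val σ) (x.val σ) := by
  simp only [lookupExp, val_add, val_load, val_mul, val_sub, val_const, val_reg, hσ.reg7]
  generalize m.val σ = m at *
  rcases m with _ | m
  · simp [Inst.Solv, Solvable]
  · simpa using (h.entry hm hx).1

theorem Inst.TableInv.step {I : Inst} {E t : ℕ} {T T' : ℕ → ℕ} (h : I.TableInv E t T)
    (h1 : ∀ x, T' x = T x ∨ x = t / I.triples E ∧ T' x = t % I.triples E + 1 ∧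
      I.Choice E (x / I.codes E) (x % I.codes E) (t % I.triples E))
    (h2 : I.Choice E (t / I.triples E / I.codes E) (t / I.triples E % I.codes E)
      (t % I.triples E) → T' (t / I.triples E) ≠ 0) : I.TableInv E (t + 1) T' := by
  refine ⟨fun x hx => ?_, fun x d hlt hd => ?_⟩
  · rcases h1 x with h3 | ⟨_, h3, h4⟩
    · rw [h3] at hx ⊢
      exact h.sound x hx
    · rwa [h3, Nat.add_sub_cancel]
  · rcases Nat.lt_succ_iff_lt_or_eq.1 hlt with h3 | h3
    · rcases h1 x with h4 | ⟨_, h4, _⟩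
      · rw [h4]; exact h.complete x d h3 hd
      · rw [h4]; omega
    · have hpos : 0 < I.triples E := by have := hd.1; omega
      have h4 : t / I.triples E = x := by
        rw [← h3, mul_comm, Nat.mul_add_div hpos, Nat.div_eq_of_lt hd.1, add_zero]
      have h5 : t % I.triples E = d := by
        rw [← h3, mul_comm, Nat.mul_add_mod, Nat.mod_eq_of_lt hd.1]
      rw [h4, h5] at h2
      exact h2 hd

/-! ## Loop invariants -/

structure Inst.LogInv (I : Inst) (E M : ℕ) (σ : State) : Prop where
  bdd : σ.Bdd M
  reg0 : σ.reg 0 = I.n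
  reg1 : σ.reg 1 = 2 ^ σ.reg 2
  reg2 : σ.reg 2 ≤ I.logSize E
  reg5 : σ.reg 5 = 0
  reg8 : σ.reg 8 = 0
  reg9 : σ.reg 9 = 0
  reg12 : σ.reg 12 = 0
  arr0 : σ.arr 0 = I.init.arr 0
  arr1 : σ.arr 1 0 = 0
  arr4 : ∀ x, σ.arr 4 x = 0
  arr6 : σ.arr 6 0 = 0

theorem Inst.LogInv.step {I : Inst} {E M : ℕ} (hM : I.Bound E M) {σ : State}
    (h : I.LogInv E M σ) (ht : (logTest E).val σ ≠ 0) : I.LogInv E M (logBody.run σ) ∧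
      I.logSize E - (logBody.run σ).reg 2 < I.logSize E - σ.reg 2 := by
  have h1 : σ.reg 2 < I.logSize E := by
    rw [Inst.logSize, Nat.lt_clog_iff_pow_lt (by norm_num), ← h.reg1]
    simp only [logTest, val_sub, val_mul, val_const, val_reg, h.reg0] at ht
    omega
  have h2 : 2 ^ (σ.reg 2 + 1) ≤ M := (Nat.pow_le_pow_right (by norm_num) h1).trans hM.two_pow
  have h3 : σ.reg 2 + 1 ≤ M := Nat.lt_two_pow_self.le.trans h2
  refine ⟨⟨?_, ?_, ?_, ?_, ?_, ?_, ?_, ?_, ?_, ?_, ?_, ?_⟩, ?_⟩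
  · refine (h.bdd.setReg ?_).setReg ?_
    · simpa [h.reg1, ← pow_succ] using h2
    · simpa [Prog.run] using h3
  all_goals simp [logBody, Prog.run, h.reg0, h.reg1, h.reg5, h.reg8, h.reg9, h.reg12, h.arr0,
    h.arr1, h.arr4, h.arr6, pow_succ]
  · omega
  · omega

structure Inst.GridInv (I : Inst) (E M : ℕ) (σ : State) : Prop where
  bdd : σ.Bdd M
  reg0 : σ.reg 0 = I.n
  reg3 : σ.reg 3 = I.prec E
  reg4 : σ.reg 4 = I.classes E
  reg5 : σ.reg 5 ≤ I.classes E
  reg6 : σ.reg 6 = grid (I.prec E) (σ.reg 5)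
  reg7 : σ.reg 7 = (I.n + 1) ^ σ.reg 5
  reg8 : σ.reg 8 = 0
  reg9 : σ.reg 9 = 0
  reg12 : σ.reg 12 = 0
  arr0 : σ.arr 0 = I.init.arr 0
  arr1 : σ.arr 1 0 = 0
  arr2 : ∀ k < σ.reg 5, σ.arr 2 k = grid (I.prec E) k
  arr3 : ∀ k < σ.reg 5, σ.arr 3 k = (I.n + 1) ^ k
  arr4 : ∀ x, σ.arr 4 x = 0
  arr6 : σ.arr 6 0 = 0

theorem Inst.LogInv.gridInv {I : Inst} {E M : ℕ} (hM : I.Bound E M) {σ : State}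
    (h : I.LogInv E M σ) (ht : (logTest E).val σ = 0) : I.GridInv E M ((paramCode E).run σ) := by
  have h1 : σ.reg 2 = I.logSize E := by
    refine le_antisymm h.reg2 ?_
    rw [Inst.logSize, Nat.clog_le_iff_le_pow (by norm_num), ← h.reg1]
    simp only [logTest, val_sub, val_mul, val_const, val_reg, h.reg0] at ht
    omega
  have h2 : E * (I.logSize E * (E * I.logSize E + 1) + 1) = I.prec E := rfl
  have h3 : 1 ≤ M := Nat.one_le_two_pow.trans hM.two_pow
  refine ⟨?_, ?_, ?_, ?_, ?_, ?_, ?_, ?_, ?_, ?_, ?_, ?_, ?_, ?_, ?_, ?_⟩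
  · refine (((h.bdd.setReg ?_).setReg ?_).setReg ?_).setReg ?_
    · simpa [h1, h2] using hM.prec
    · simpa [Prog.run, h1, h2, Inst.classes] using hM.classes
    · simpa using h3
    · simpa using h3
  all_goals simp [paramCode, Prog.run, h.reg0, h.reg5, h.reg8, h.reg9, h.reg12, h.arr0,
    h.arr1, h.arr4, h.arr6, h1, h2, Inst.classes, grid]

theorem Inst.GridInv.step {I : Inst} {E M : ℕ} (hM : I.Bound E M) {σ : State}
    (h : I.GridInv E M σ) (ht : (reg 4 - reg 5 : AExp).val σ ≠ 0) :
    I.GridInv E M (gridBody.run σ) ∧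
      I.classes E - (gridBody.run σ).reg 5 < I.classes E - σ.reg 5 := by
  have h1 : σ.reg 5 < I.classes E := by
    simp only [val_sub, val_reg, h.reg4] at ht
    omega
  have h2 : grid (I.prec E) (σ.reg 5 + 1) ≤ M := hM.grid _ h1
  have h3 : (I.n + 1) ^ (σ.reg 5 + 1) ≤ M :=
    (Nat.pow_le_pow_right (Nat.succ_pos _) h1).trans hM.codes
  have h4 : grid (I.prec E) (σ.reg 5) + 1 + grid (I.prec E) (σ.reg 5) / I.prec E =
    grid (I.prec E) (σ.reg 5 + 1) := rfl
  have h5 : (I.n + 1) ^ σ.reg 5 ≤ M :=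
    (Nat.pow_le_pow_right (Nat.succ_pos _) h1.le).trans hM.codes
  refine ⟨⟨?_, ?_, ?_, ?_, ?_, ?_, ?_, ?_, ?_, ?_, ?_, ?_, ?_, ?_, ?_, ?_⟩, ?_⟩
  · refine ((((h.bdd.setArr ?_).setArr ?_).setReg ?_).setReg ?_).setReg ?_
    · simpa [h.reg6] using hM.grid _ h1.le
    · simpa [Prog.run, h.reg7] using h5
    · simpa [Prog.run, h.reg6, h.reg3, h4] using h2
    · simpa [Prog.run, h.reg7, h.reg0, ← pow_succ] using h3
    · simpa [Prog.run] using (show σ.reg 5 + 1 ≤ M from h1.trans_le hM.classes)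
  all_goals simp [gridBody, Prog.run, h.reg0, h.reg3, h.reg4, h.reg6, h.reg7, h.reg8, h.reg9,
    h.reg12, h.arr0, h.arr1, h.arr4, h.arr6, pow_succ, h4]
  · omega
  · intro k hk
    rcases hk.lt_or_eq with hk | rfl
    · rw [Function.update_of_ne hk.ne, h.arr2 k hk]
    · simp
  · intro k hk
    rcases hk.lt_or_eq with hk | rfl
    · rw [Function.update_of_ne hk.ne, h.arr3 k hk]
    · simp
  · omega

/-- The number of steps of the dynamic program. -/
def Inst.steps (I : Inst) (E : ℕ) : ℕ := (I.n - 1) * I.codes E * I.triples E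

structure Inst.DPInv (I : Inst) (E M : ℕ) (σ : State) : Prop where
  tables : I.Tables E M σ
  reg8 : σ.reg 8 ≤ I.steps E
  reg9 : σ.reg 9 = 0
  reg12 : σ.reg 12 = 0
  arr1 : σ.arr 1 0 = 0
  arr4 : I.TableInv E (σ.reg 8) (σ.arr 4)
  arr6 : σ.arr 6 0 = 0

theorem Inst.GridInv.dpInv {I : Inst} {E M : ℕ} {σ : State}
    (h : I.GridInv E M σ) (ht : (reg 4 - reg 5 : AExp).val σ = 0) : I.DPInv E M σ := by
  have h1 : σ.reg 5 = I.classes E := by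
    simp only [val_sub, val_reg, h.reg4] at ht
    have := h.reg5
    omega
  refine ⟨⟨h.bdd, h.reg0, h.reg4, ?_, h.arr0, h1 ▸ h.arr2, h1 ▸ h.arr3⟩, by simp [h.reg8], h.reg9,
    h.reg12, h.arr1, ⟨fun x hx => (hx (h.arr4 x)).elim, fun x d hlt => ?_⟩, h.arr6⟩
  · rw [h.reg7, h1]; rfl
  · rw [h.reg8] at hlt; omega

theorem Inst.DPInv.step {I : Inst} {E M : ℕ} (hM : I.Bound E M) {σ : State}
    (h : I.DPInv E M σ) (ht : dpTest.val σ ≠ 0) : I.DPInv E M ((dpBody E).run σ) ∧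
      I.steps E - ((dpBody E).run σ).reg 8 < I.steps E - σ.reg 8 := by
  have hT := h.tables
  have h1 : σ.reg 8 < I.steps E := by
    simp only [dpTest, val_sub, val_mul, val_reg, val_const, hT.reg0, hT.reg7, hT.val_cube] at ht
    unfold Inst.steps
    omega
  have hpos : 0 < I.triples E := Nat.pos_of_ne_zero fun h0 => by simp [Inst.steps, h0] at h1
  have hc := I.codes_pos E
  set x := σ.reg 8 / I.triples E with hx
  set d := σ.reg 8 % I.triples E with hd
  have hd3 : d < I.triples E := Nat.mod_lt _ hpos
  have hvalx : (reg 8 / cubeExp : AExp).val σ = x := by simp [hT.val_cube, hx]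
  have hvald : (mod (reg 8) cubeExp).val σ = d := by simp [hT.val_cube, hd]
  have hvalm : (reg 8 / cubeExp / reg 7 : AExp).val σ = x / I.codes E := by
    rw [val_div, hvalx, val_reg, hT.reg7]
  have hvaly : (mod (reg 8 / cubeExp) (reg 7)).val σ = x % I.codes E := by
    rw [val_mod, hvalx, val_reg, hT.reg7]
  have hcond : (dpCond E).val σ ≠ 0 ↔ I.Choice E (x / I.codes E) (x % I.codes E) d := by
    have hd' : (mod (reg 8) cubeExp).val σ < I.triples E := by rwa [hvald]
    unfold dpCond Inst.Choice
    rw [val_mul, mul_ne_zero_iff, hT.val_valid hd', hvalm, hvaly, hvald]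
    refine ⟨fun ⟨hv, hl⟩ => ⟨hd3, hv, ?_⟩, fun ⟨_, hv, hl⟩ => ⟨hv, ?_⟩⟩
    all_goals
      -- The lookup concerns the preceding row, which is already finished at the current counter;
      -- the test that the next code is below `codes` keeps the index inside that row.
      have hlook := h.arr4.lookup hT (m := reg 8 / cubeExp / reg 7)
        (x := nextExp (mod (reg 8 / cubeExp) (reg 7)) (mod (reg 8) cubeExp))
        (by
          rw [hvalm]
          exact (Nat.mul_le_mul_right _ (Nat.div_mul_le_self _ _)).trans
            (Nat.div_mul_le_self _ _))
        (by rw [hT.val_next hd', hvaly, hvald]; exact hv.2.2.2.2)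
      rw [hT.val_next hd', hvalm, hvaly, hvald] at hlook
    · exact hlook.1 hl
    · exact hlook.2 hl
  have h8 : σ.reg 8 + 1 ≤ M := h1.trans_le hM.time
  by_cases hC : I.Choice E (x / I.codes E) (x % I.codes E) d
  · have hrun : (dpBody E).run σ = (σ.setArr 4 x (d + 1)).setReg 8 (σ.reg 8 + 1) := by
      simp only [dpBody, Prog.run, hcond.2 hC, ne_eq, not_false_eq_true, if_true, hvalx, val_add,
        hvald, val_reg, val_const, State.setArr_reg]
    rw [hrun]
    have hbdd := (hT.bdd.setArr (a := 4) (i := x) (v := d + 1) (hd3.trans_le hM.triples)).setReg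
      (x := 8) h8
    refine ⟨⟨⟨hbdd, ?_, ?_, ?_, ?_, ?_, ?_⟩, ?_, ?_, ?_, ?_, ?_, ?_⟩, ?_⟩
    · simpa using hT.reg0
    · simpa using hT.reg4
    · simpa using hT.reg7
    · simpa using hT.arr0
    · simpa using hT.arr2
    · simpa using hT.arr3
    · simpa using h1
    · simpa using h.reg9
    · simpa using h.reg12
    · simpa using h.arr1
    · simp only [State.setReg_reg, State.setReg_arr, State.setArr_arr, if_true]
      refine h.arr4.step (fun y => ?_) fun _ => by simp [hx]
      by_cases hy : y = x
      · right
        subst hy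
        exact ⟨rfl, by simp [hd], hC⟩
      · left
        rw [Function.update_of_ne hy]
    · simpa using h.arr6
    · simp only [State.setReg_reg, if_true]; omega
  · have hC' : (dpCond E).val σ = 0 := by rwa [← not_iff_not.2 hcond, not_not] at hC
    have hrun : (dpBody E).run σ = σ.setReg 8 (σ.reg 8 + 1) := by
      simp [dpBody, Prog.run, hC']
    rw [hrun]
    refine ⟨⟨⟨hT.bdd.setReg h8, ?_, ?_, ?_, ?_, ?_, ?_⟩, ?_, ?_, ?_, ?_, ?_, ?_⟩, ?_⟩
    · simpa using hT.reg0
    · simpa using hT.reg4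
    · simpa using hT.reg7
    · simpa using hT.arr0
    · simpa using hT.arr2
    · simpa using hT.arr3
    · simpa using h1
    · simpa using h.reg9
    · simpa using h.reg12
    · simpa using h.arr1
    · simp only [State.setReg_reg, State.setReg_arr, if_true]
      exact h.arr4.step (fun y => .inl rfl) fun h' => (hC h').elim
    · simpa using h.arr6
    · simp only [State.setReg_reg, if_true]; omega

/-- A total length of class `D` suffices. -/
structure Inst.Length (I : Inst) (E D : ℕ) : Prop where
  lt : D < I.classes E
  le : I.n * E ≤ grid (I.prec E) D
  solv : I.Solv E (I.n - 1) ((I.n + 1) ^ D)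

structure Inst.LengthInv (I : Inst) (E M D : ℕ) (σ : State) : Prop where
  tables : I.Tables E M σ
  reg9 : σ.reg 9 ≤ D
  reg12 : σ.reg 12 = 0
  arr1 : σ.arr 1 0 = 0
  arr4 : I.TableInv E (I.steps E) (σ.arr 4)
  arr6 : σ.arr 6 0 = 0

theorem Inst.DPInv.lengthInv {I : Inst} {E M : ℕ} {σ : State} (h : I.DPInv E M σ)
    (ht : dpTest.val σ = 0) (D : ℕ) : I.LengthInv E M D σ := by
  have hT := h.tables
  have h1 : σ.reg 8 = I.steps E := by
    simp only [dpTest, val_sub, val_mul, val_reg, val_const, hT.reg0, hT.reg7, hT.val_cube] at ht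
    have := h.reg8
    unfold Inst.steps at *
    omega
  exact ⟨hT, by simp [h.reg9], h.reg12, h.arr1, h1 ▸ h.arr4, h.arr6⟩

theorem Inst.LengthInv.test {I : Inst} {E M D : ℕ} {σ : State} (h : I.LengthInv E M D σ)
    (hD : D < I.classes E) : (lengthTest E).val σ = 0 ↔ I.Length E (σ.reg 9) := by
  have hT := h.tables
  have hn : 0 < I.n + 1 := Nat.succ_pos _
  have h9 : σ.reg 9 < I.classes E := h.reg9.trans_lt hD
  have h2 : (load 3 (reg 9)).val σ = (I.n + 1) ^ σ.reg 9 := by simp [hT.arr3 _ h9]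
  have hm : (reg 0 - const 1 : AExp).val σ = I.n - 1 := by simp [hT.reg0]
  have hle : ∀ a : ℕ, 1 - a = 0 ↔ a ≠ 0 := fun a => by omega
  unfold lengthTest
  rw [val_sub, val_const, val_mul, hle, mul_ne_zero_iff, val_le_ne_zero]
  by_cases hn1 : I.n = 0
  · have hs : I.Solv E (I.n - 1) ((I.n + 1) ^ σ.reg 9) := by simp [hn1, Inst.Solv, Solvable]
    have : (lookupExp (reg 0 - const 1) (load 3 (reg 9))).val σ ≠ 0 := by
      simp [lookupExp, hT.reg0, hn1]
    simp only [this, ne_eq, not_false_eq_true, true_and, val_mul, val_reg, val_const, val_load,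
      hT.reg0, hT.arr2 _ h9]
    exact ⟨fun h => ⟨h9, h, hs⟩, fun h => h.le⟩
  · rw [h.arr4.lookup hT (by rw [hm]; rfl)
      (by rw [h2]; exact Nat.pow_lt_pow_right (by omega) h9), hm, h2]
    simp only [val_mul, val_reg, val_const, val_load, hT.reg0, hT.arr2 _ h9]
    exact ⟨fun ⟨h3, h4⟩ => ⟨h9, h4, h3⟩, fun h => ⟨h.solv, h.le⟩⟩

theorem Inst.LengthInv.step {I : Inst} {E M D : ℕ} (hM : I.Bound E M) (hD : I.Length E D)
    {σ : State} (h : I.LengthInv E M D σ) (ht : (lengthTest E).val σ ≠ 0) :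
    I.LengthInv E M D (lengthBody.run σ) ∧ D - (lengthBody.run σ).reg 9 < D - σ.reg 9 := by
  have hT := h.tables
  have h1 : σ.reg 9 < D := by
    refine lt_of_le_of_ne h.reg9 fun h2 => ht ?_
    rw [h.test hD.lt, h2]
    exact hD
  have hrun : lengthBody.run σ = σ.setReg 9 (σ.reg 9 + 1) := by simp [lengthBody, Prog.run]
  rw [hrun]
  refine ⟨⟨⟨hT.bdd.setReg ?_, ?_, ?_, ?_, ?_, ?_, ?_⟩, ?_, ?_, ?_, ?_, ?_⟩, ?_⟩
  · exact h1.trans (hD.lt.trans_le hM.classes)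
  · simpa using hT.reg0
  · simpa using hT.reg4
  · simpa using hT.reg7
  · simpa using hT.arr0
  · simpa using hT.arr2
  · simpa using hT.arr3
  · simpa using h1
  · simpa using h.reg12
  · simpa using h.arr1
  · simpa using h.arr4
  · simpa using h.arr6
  · simp only [State.setReg_reg, if_true]; omega

/-- The entry of the table that is used for inserting the current job. -/
def chosen (I : Inst) (E : ℕ) (σ : State) : ℕ :=
  σ.arr 4 ((I.n - 1 - σ.reg 11) * I.codes E + σ.reg 10) - 1

structure Inst.BuildInv (I : Inst) (E M D : ℕ) (σ : State) : Prop where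
  tables : I.Tables E M σ
  table : I.TableInv E (I.steps E) (σ.arr 4)
  one_le : 1 ≤ σ.reg 11
  le : σ.reg 11 ≤ I.n
  reg10 : σ.reg 10 = code (I.n + 1) ((Multiset.range (σ.reg 11)).map (σ.arr 5))
  solv : I.Solv E (I.n - σ.reg 11) (σ.reg 10)
  skipped : σ.reg 11 < I.n → ∀ l < σ.reg 12, l < σ.reg 11 →
    σ.arr 5 l ≠ chosen I E σ / (I.classes E * I.classes E)
  cls : ∀ l < σ.reg 11, σ.arr 5 l < I.classes E
  placed : I.Placed E (grid (I.prec E)) (grid (I.prec E) D) (σ.reg 11) (σ.arr 5) (σ.arr 6)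
  out : ∀ l < σ.reg 11, σ.arr 1 l = σ.arr 6 l * I.init.arr 0 0 / (I.n * E)

theorem Inst.LengthInv.buildInv {I : Inst} {E M D : ℕ} (hn : 0 < I.n) (hM : I.Bound E M)
    (hD : D < I.classes E) {σ : State} (h : I.LengthInv E M D σ)
    (ht : (lengthTest E).val σ = 0) : I.BuildInv E M (σ.reg 9) (startCode.run σ) := by
  have hT := h.tables
  rw [h.test hD] at ht
  have hrun : startCode.run σ =
      ((σ.setArr 5 0 (σ.reg 9)).setReg 10 ((I.n + 1) ^ σ.reg 9)).setReg 11 1 := by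
    simp [startCode, Prog.run, hT.arr3 _ ht.lt]
  rw [hrun]
  have hpow : (I.n + 1) ^ σ.reg 9 ≤ M :=
    (Nat.pow_le_pow_right (Nat.succ_pos _) ht.lt.le).trans hM.codes
  have hp := h.arr6
  refine ⟨⟨?_, ?_, ?_, ?_, ?_, ?_, ?_⟩, ?_, ?_, ?_, ?_, ?_, ?_, ?_, ?_, ?_⟩
  · exact ((hT.bdd.setArr (hT.bdd.1 9)).setReg hpow).setReg (hn.trans_le hM.n)
  · simpa using hT.reg0
  · simpa using hT.reg4
  · simpa using hT.reg7
  · simpa using hT.arr0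
  · simpa using hT.arr2
  · simpa using hT.arr3
  · simpa using h.arr4
  · simp
  · simpa using Nat.succ_le_of_lt hn
  · simp [code]
  · simpa using ht.solv
  · simp [h.reg12]
  · simpa using ht.lt
  · simp only [State.setReg_reg, if_true, State.setReg_arr, State.setArr_arr]
    refine ⟨fun i hi l hl => by omega, fun i hi => ?_, fun i hi => ?_, fun i hi l hl => by omega⟩
    · obtain rfl : i = 0 := by omega
      simp [hp]
    · obtain rfl : i = 0 := by omega
      -- Job 0 is placed at the default value 0 and is never tested by a split; that it fits is the
      -- condition `n * E ≤ grid D` in `Inst.Length`.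
      rw [if_neg (by norm_num), hp, zero_mul, zero_add, mul_comm]
      exact Nat.mul_le_mul_right _ ht.le
  · intro l hl
    obtain rfl : l = 0 := by simpa using hl
    simp [hp, h.arr1]

/-- Keeps the code in register 10 in step with the array of classes: the slot of job `i` takes the
first part and the new slot `j` the second. -/
theorem code_update {n K j i d : ℕ} {cls : ℕ → ℕ} (hi : i < j) (hc : cls i = d / (K * K)) :
    nextCode n K (code (n + 1) ((Multiset.range j).map cls)) d =
      code (n + 1) ((Multiset.range (j + 1)).map
        (Function.update (Function.update cls i (d % K)) j (d / K % K))) := by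
  have h1 : Multiset.range j = i ::ₘ (Multiset.range j).erase i :=
    (Multiset.cons_erase (by simpa using hi)).symm
  have h2 : ((Multiset.range j).erase i).map
      (Function.update (Function.update cls i (d % K)) j (d / K % K)) =
      ((Multiset.range j).erase i).map cls := by
    refine Multiset.map_congr rfl fun l hl => ?_
    rw [(Multiset.nodup_range j).mem_erase_iff, Multiset.mem_range] at hl
    rw [Function.update_of_ne hl.2.ne, Function.update_of_ne hl.1]
  rw [Multiset.range_succ, Multiset.map_cons, code_cons, Function.update_self, h1,
    Multiset.map_cons, Multiset.map_cons, code_cons, code_cons, h2,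
    Function.update_of_ne hi.ne, Function.update_self, hc]
  unfold nextCode
  omega

theorem Inst.BuildInv.step {I : Inst} {E M D : ℕ} (hM : I.Bound E M) (hD : D < I.classes E)
    {σ : State} (h : I.BuildInv E M D σ) (ht : buildTest.val σ ≠ 0) :
    I.BuildInv E M D ((buildBody E).run σ) ∧
      -- A lexicographic variant: an insertion resets the scan but gains `n + 1`, more than the scan
      -- can lose.
      (I.n - ((buildBody E).run σ).reg 11) * (I.n + 1) + (I.n - ((buildBody E).run σ).reg 12) <
        (I.n - σ.reg 11) * (I.n + 1) + (I.n - σ.reg 12) := by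
  have hT := h.tables
  obtain ⟨j, hj⟩ : ∃ j, j = σ.reg 11 := ⟨_, rfl⟩
  obtain ⟨i, hi⟩ : ∃ i, i = σ.reg 12 := ⟨_, rfl⟩
  obtain ⟨d, hd⟩ : ∃ d, d = chosen I E σ := ⟨_, rfl⟩
  have hjn : j < I.n := by
    simp only [buildTest, val_sub, val_reg, hT.reg0] at ht
    omega
  have hcode : σ.reg 10 < I.codes E := by
    rw [h.reg10]
    refine code_lt (fun c hc => ?_) ?_
    · obtain ⟨l, hl, rfl⟩ := Multiset.mem_map.1 hc
      exact h.cls l (Multiset.mem_range.1 hl)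
    · rw [Multiset.card_map, Multiset.card_range]; omega
  have hrem : I.n - σ.reg 11 = I.n - 1 - σ.reg 11 + 1 := by omega
  have hchoice : I.Choice E (I.n - 1 - j) (σ.reg 10) d := by
    have h1 := h.table.entry (m := I.n - 1 - σ.reg 11) (y := σ.reg 10)
      (by
        unfold Inst.steps
        gcongr
        have := h.one_le
        omega) hcode
    rw [hj, hd]
    exact h1.2 (h1.1.2 (hrem ▸ h.solv))
  obtain ⟨hd3, ⟨hab, ha, hb, hdig, hnext⟩, hsolv⟩ := hchoice
  rw [show I.n - 1 - (I.n - 1 - j) = j by omega] at ha hb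
  obtain ⟨haK, hbK, hcK⟩ := triple_lt hd3
  -- The digit of the chosen class is nonzero, so some gap has this class; had the scan passed all
  -- of them, `skipped` would be violated.
  have hij : i < j := by
    rw [h.reg10, code_div_mod_ne_zero (by rw [Multiset.card_map, Multiset.card_range]; omega),
      Multiset.mem_map] at hdig
    obtain ⟨l, hl, hlc⟩ := hdig
    rw [Multiset.mem_range] at hl
    by_contra hij
    exact h.skipped (by omega) l (by omega) hl (hlc.trans (by rw [hd]))
  have hpick : (load 4 ((reg 0 - const 1 - reg 11) * reg 7 + reg 10) - const 1 : AExp).val σ = d := by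
    simp [hT.reg0, hT.reg7, hd, chosen]
  have hdM : d ≤ M := (hd3.trans_le hM.triples).le
  set σ₁ := σ.setReg 13 d with hσ₁
  have hT₁ : I.Tables E M σ₁ := by
    refine ⟨hT.bdd.setReg hdM, ?_, ?_, ?_, ?_, ?_, ?_⟩
    · simpa [hσ₁] using hT.reg0
    · simpa [hσ₁] using hT.reg4
    · simpa [hσ₁] using hT.reg7
    · simpa [hσ₁] using hT.arr0
    · simpa [hσ₁] using hT.arr2
    · simpa [hσ₁] using hT.arr3
  have hcond : (eq (load 5 (reg 12)) (gapClass (reg 13))).val σ₁ ≠ 0 ↔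
      σ.arr 5 i = d / (I.classes E * I.classes E) := by
    rw [val_eq_ne_zero]
    simp [gapClass, hσ₁, hi, hT.reg4]
  by_cases hc : σ.arr 5 i = d / (I.classes E * I.classes E)
  · have hposj : σ.arr 6 i + grid (I.prec E) (d % I.classes E) ≤ grid (I.prec E) D := by
      have := h.placed.inside i (hj ▸ hij)
      rw [hc] at this
      omega
    set v := σ.arr 6 i + grid (I.prec E) (d % I.classes E) with hv
    set w := v * I.init.arr 0 0 / (I.n * E) with hw
    set τ := ((((((σ₁.setArr 6 j v).setArr 1 j w).setArr 5 i (d % I.classes E)).setArr 5 j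
      (d / I.classes E % I.classes E)).setReg 10
        (nextCode I.n (I.classes E) (σ.reg 10) d)).setReg 11 (j + 1)).setReg 12 0 with hτ
    have hrun : (buildBody E).run σ = τ := by
      have hnextval : ∀ ρ : State, (ρ.reg 10 = σ.reg 10) → ρ.reg 13 = d →
          ρ.reg 4 = I.classes E → ρ.arr 3 = σ.arr 3 →
          (nextExp (reg 10) (reg 13)).val ρ = nextCode I.n (I.classes E) (σ.reg 10) d := by
        intro ρ h1 h2 h3 h4
        simp [nextExp, nextCode, fstClass, sndClass, gapClass, h1, h2, h3, h4, hT.arr3 _ haK,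
          hT.arr3 _ hbK, hT.arr3 _ hcK]
      have h1 : (buildBody E).run σ = (insertCode E).run σ₁ := by
        simp only [buildBody, Prog.run, hpick]
        rw [← hσ₁, if_pos (hcond.2 hc)]
      rw [h1]
      simp only [insertCode, Prog.run]
      rw [hnextval]
      · simp [hτ, hσ₁, fstClass, sndClass, hT.reg4, hT.reg0, hT.arr0, hT.arr2 _ haK, ← hi, ← hj,
          hv, hw]
      · simp [hσ₁]
      · simp [hσ₁]
      · simp [hσ₁, hT.reg4]
      · simp [hσ₁]
    rw [hrun]
    have hvM : v ≤ M := hposj.trans (hM.grid D hD.le)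
    have hwM : w ≤ M := (Nat.div_le_self _ _).trans
      ((Nat.mul_le_mul_right _ hposj).trans (hM.out D hD.le))
    have hbdd : τ.Bdd M := by
      refine ((((((hT₁.bdd.setArr hvM).setArr hwM).setArr ?_).setArr ?_).setReg ?_).setReg
        ?_).setReg (Nat.zero_le _)
      · exact haK.le.trans hM.classes
      · exact hbK.le.trans hM.classes
      · exact hnext.le.trans hM.codes
      · exact hjn.trans_le hM.n
    have hτ5 : τ.arr 5 = Function.update (Function.update (σ.arr 5) i (d % I.classes E)) j
        (d / I.classes E % I.classes E) := by simp [hτ, hσ₁]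
    have hτ6 : τ.arr 6 = Function.update (σ.arr 6) j v := by simp [hτ, hσ₁]
    have hτ1 : τ.arr 1 = Function.update (σ.arr 1) j w := by simp [hτ, hσ₁]
    have hτ11 : τ.reg 11 = j + 1 := by simp [hτ]
    have hτ12 : τ.reg 12 = 0 := by simp [hτ]
    have hτ10 : τ.reg 10 = nextCode I.n (I.classes E) (σ.reg 10) d := by simp [hτ]
    refine ⟨⟨⟨hbdd, ?_, ?_, ?_, ?_, ?_, ?_⟩, ?_, ?_, ?_, ?_, ?_, ?_, ?_, ?_, ?_⟩, ?_⟩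
    · simpa [hτ] using hT₁.reg0
    · simpa [hτ] using hT₁.reg4
    · simpa [hτ] using hT₁.reg7
    · simpa [hτ] using hT₁.arr0
    · simpa [hτ] using hT₁.arr2
    · simpa [hτ] using hT₁.arr3
    · simpa [hτ, hσ₁] using h.table
    · omega
    · omega
    · rw [hτ10, hτ11, hτ5, h.reg10, ← hj]
      exact code_update hij hc
    · rw [hτ10, hτ11, show I.n - (j + 1) = I.n - 1 - j by omega]
      exact hsolv
    · intro _ l hl; omega
    · rw [hτ11, hτ5]
      intro l hl
      rw [Function.update_apply, Function.update_apply]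
      split_ifs
      exacts [hbK, haK, h.cls l (by omega)]
    · rw [hτ11, hτ5, hτ6]
      exact (hj ▸ h.placed).insert hij (hc ▸ hab) ha hb
    · rw [hτ11, hτ1, hτ6]
      intro l hl
      by_cases hlj : l = j
      · subst hlj; simp [hw]
      · rw [Function.update_of_ne hlj, Function.update_of_ne hlj]
        exact h.out l (by omega)
    · rw [hτ11, hτ12, ← hj, ← hi, show I.n - j = I.n - (j + 1) + 1 by omega, add_mul]
      omega
  · have hrun : (buildBody E).run σ = σ₁.setReg 12 (i + 1) := by
      simp only [buildBody, Prog.run, hpick]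
      rw [← hσ₁, if_neg (by rwa [hcond])]
      simp [hσ₁, hi]
    rw [hrun]
    have hch : chosen I E (σ₁.setReg 12 (i + 1)) = d := by
      rw [hd]; simp [chosen, hσ₁]
    refine ⟨⟨⟨hT₁.bdd.setReg ?_, ?_, ?_, ?_, ?_, ?_, ?_⟩, ?_, ?_, ?_, ?_, ?_, ?_, ?_, ?_, ?_⟩,
      ?_⟩
    · have := hM.n; omega
    · simpa using hT₁.reg0
    · simpa using hT₁.reg4
    · simpa using hT₁.reg7
    · simpa using hT₁.arr0
    · simpa using hT₁.arr2
    · simpa using hT₁.arr3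
    · simpa [hσ₁] using h.table
    · simpa [hσ₁] using h.one_le
    · simpa [hσ₁] using h.le
    · simpa [hσ₁] using h.reg10
    · simpa [hσ₁] using h.solv
    · rw [hch]
      intro _ l hl hlj
      have hl' : l < i + 1 := by simpa using hl
      have hlj' : l < σ.reg 11 := by simpa [hσ₁] using hlj
      have h5 : (σ₁.setReg 12 (i + 1)).arr 5 l = σ.arr 5 l := rfl
      rw [h5]
      rcases Nat.lt_succ_iff_lt_or_eq.1 hl' with hl | rfl
      · exact hd ▸ h.skipped (by omega) l (by omega) hlj'
      · exact hc
    · simpa [hσ₁] using h.cls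
    · simpa [hσ₁] using h.placed
    · simpa [hσ₁] using h.out
    · simp only [State.setReg_reg, hσ₁, if_true]
      norm_num
      omega

theorem Inst.BuildInv.result {I : Inst} {E M D : ℕ} (hn : 0 < I.n) (hE : 0 < E)
    {σ : State} (h : I.BuildInv E M D σ) (ht : buildTest.val σ = 0) :
    I.Feasible (I.output σ) ∧ ∀ i, I.output σ i + I.p i ≤
      grid (I.prec E) D * ((I.init.arr 0 0 : ℝ) / (I.n * E)) := by
  have hj : σ.reg 11 = I.n := by
    simp only [buildTest, val_sub, val_reg, h.tables.reg0] at ht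
    have := h.le
    omega
  have hnE : 0 < I.n * E := Nat.mul_pos hn hE
  have hout : ∀ i : Fin I.n, I.output σ i =
      ((σ.arr 6 i * I.init.arr 0 0 / (I.n * E) : ℕ) : ℝ) := fun i => by
    rw [Inst.output, h.out i (by rw [hj]; exact i.2)]
  -- Converting units to time by integer division keeps distances, since the job sizes are integers.
  have hdiv : ∀ x y q : ℕ, x + q * (I.n * E) ≤ y → x / (I.n * E) + q ≤ y / (I.n * E) :=
    fun x y q hxy => by
      rw [← Nat.add_mul_div_right _ _ hnE]
      exact Nat.div_le_div_right hxy
  have hsep : ∀ i l : Fin I.n, l < i → (I.p i : ℝ) ≤ |I.output σ i - I.output σ l| := by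
    intro i l hl
    rw [hout, hout, ← I.init_arr_zero i, le_abs]
    rcases h.placed.sep i (by rw [hj]; exact i.2) l hl with h1 | h1
    · right
      have h2 := hdiv _ _ _ h1
      have h3 : ((σ.arr 6 i * I.init.arr 0 0 / (I.n * E) : ℕ) : ℝ) + (I.init.arr 0 i : ℝ) ≤
        ((σ.arr 6 l * I.init.arr 0 0 / (I.n * E) : ℕ) : ℝ) := by exact_mod_cast h2
      linarith
    · left
      have h2 := hdiv _ _ _ h1
      have h3 : ((σ.arr 6 l * I.init.arr 0 0 / (I.n * E) : ℕ) : ℝ) + (I.init.arr 0 i : ℝ) ≤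
        ((σ.arr 6 i * I.init.arr 0 0 / (I.n * E) : ℕ) : ℝ) := by exact_mod_cast h2
      linarith
  refine ⟨⟨fun i => Nat.cast_nonneg _, fun i l hil => ?_⟩, fun i => ?_⟩
  · rcases lt_or_gt_of_ne hil with h1 | h1
    · rw [abs_sub_comm]
      exact (min_le_right _ _).trans (hsep l i h1)
    · exact (min_le_left _ _).trans (hsep i l h1)
  · have h1 := hdiv _ _ _ (h.placed.makespan i (by rw [hj]; exact i.2))
    rw [hout, ← I.init_arr_zero i]
    have h3 : ((σ.arr 6 i * I.init.arr 0 0 / (I.n * E) : ℕ) : ℝ) + (I.init.arr 0 i : ℝ) ≤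
        ((grid (I.prec E) D * I.init.arr 0 0 / (I.n * E) : ℕ) : ℝ) := by exact_mod_cast h1
    refine h3.trans (Nat.cast_div_le.trans (le_of_eq ?_))
    push_cast
    ring

/-! ## Running the program -/

theorem Inst.init_bdd {I : Inst} {E M : ℕ} (hM : I.Bound E M) : I.init.Bdd M := by
  refine ⟨fun x => ?_, fun a i => ?_⟩
  · simp only [Inst.init]
    split_ifs
    exacts [hM.n, Nat.zero_le _]
  · by_cases ha : a = 0
    · subst ha; exact hM.p i
    · simp [Inst.init, ha]

theorem Inst.logInv_init {I : Inst} {E M : ℕ} (hM : I.Bound E M) :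
    I.LogInv E M ((assign 1 (const 1)).run I.init) := by
  have h1 : 1 ≤ M := Nat.one_le_two_pow.trans hM.two_pow
  have hb := Inst.init_bdd hM
  refine ⟨hb.setReg (by simpa using h1), ?_, ?_, ?_, ?_, ?_, ?_, ?_, ?_, ?_, ?_, ?_⟩
  all_goals simp [Prog.run, Inst.init]

/-- A bound on the number of steps in each loop of the program. -/
def Inst.iterations (I : Inst) (E : ℕ) : ℕ :=
  I.logSize E + I.classes E + I.steps E + (I.n + 1) ^ 2 + 1

/-- The length loop starts at class 0 and stops at the first class passing the test, so its result
is at most any admissible `D`. -/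
theorem exec_scheme (E : ℕ) : ∃ C, ∀ (I : Inst) (M D : ℕ), 0 < I.n → I.Bound E M →
    I.Length E D → ∃ τ t D', Exec (scheme E) I.init τ t ∧
      t ≤ C * (I.iterations E * (M.size + 1)) ∧ D' ≤ D ∧ I.BuildInv E M D' τ ∧
      buildTest.val τ = 0 := by
  obtain ⟨C₁, h₁⟩ := exec_straight (assign 1 (const 1)) trivial
  obtain ⟨C₂, h₂⟩ := exec_loop (logTest E) logBody ⟨trivial, trivial⟩
  obtain ⟨C₃, h₃⟩ := exec_straight (paramCode E) ⟨trivial, trivial, trivial, trivial⟩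
  obtain ⟨C₄, h₄⟩ := exec_loop (reg 4 - reg 5) gridBody ⟨trivial, trivial, trivial, trivial, trivial⟩
  obtain ⟨C₅, h₅⟩ := exec_loop dpTest (dpBody E) ⟨⟨trivial, trivial⟩, trivial⟩
  obtain ⟨C₆, h₆⟩ := exec_loop (lengthTest E) lengthBody trivial
  obtain ⟨C₇, h₇⟩ := exec_straight startCode ⟨trivial, trivial, trivial⟩
  obtain ⟨C₈, h₈⟩ := exec_loop buildTest (buildBody E)
    ⟨trivial, ⟨trivial, trivial, trivial, trivial, trivial, trivial, trivial⟩, trivial⟩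
  refine ⟨C₁ + C₂ + C₃ + C₄ + C₅ + C₆ + C₇ + C₈ + 2, fun I M D hn hM hD => ?_⟩
  have hinit := Inst.init_bdd hM
  obtain ⟨t₁, ht₁, e₁⟩ := h₁ M I.init hinit
  have i₁ := Inst.logInv_init hM
  obtain ⟨σ₂, t₂, e₂, ht₂, i₂, z₂⟩ := h₂ M (I.LogInv E M) (fun σ => I.logSize E - σ.reg 2)
    (fun σ h => h.bdd) (fun σ h ht => h.step hM ht) _ i₁
  obtain ⟨t₃, ht₃, e₃⟩ := h₃ M σ₂ i₂.bdd
  have i₃ := i₂.gridInv hM z₂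
  obtain ⟨σ₄, t₄, e₄, ht₄, i₄, z₄⟩ := h₄ M (I.GridInv E M) (fun σ => I.classes E - σ.reg 5)
    (fun σ h => h.bdd) (fun σ h ht => h.step hM ht) _ i₃
  obtain ⟨σ₅, t₅, e₅, ht₅, i₅, z₅⟩ := h₅ M (I.DPInv E M) (fun σ => I.steps E - σ.reg 8)
    (fun σ h => h.tables.bdd) (fun σ h ht => h.step hM ht) _ (i₄.dpInv z₄)
  obtain ⟨σ₆, t₆, e₆, ht₆, i₆, z₆⟩ := h₆ M (I.LengthInv E M D) (fun σ => D - σ.reg 9)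
    (fun σ h => h.tables.bdd) (fun σ h ht => h.step hM hD ht) _ (i₅.lengthInv z₅ D)
  obtain ⟨t₇, ht₇, e₇⟩ := h₇ M σ₆ i₆.tables.bdd
  have i₇ := i₆.buildInv hn hM hD.lt z₆
  have h9 : σ₆.reg 9 < I.classes E := i₆.reg9.trans_lt hD.lt
  obtain ⟨σ₈, t₈, e₈, ht₈, i₈, z₈⟩ := h₈ M (I.BuildInv E M (σ₆.reg 9))
    (fun σ => (I.n - σ.reg 11) * (I.n + 1) + (I.n - σ.reg 12))
    (fun σ h => h.tables.bdd) (fun σ h ht => h.step hM h9 ht) _ i₇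
  refine ⟨σ₈, _, σ₆.reg 9, Exec.iteTrue ?_ (Exec.seq e₁ (Exec.seq e₂ (Exec.seq e₃ (Exec.seq e₄
    (Exec.seq e₅ (Exec.seq e₆ (Exec.seq e₇ e₈))))))), ?_, i₆.reg9, i₈, z₈⟩
  · simpa [Inst.init] using hn.ne'
  · set Q := I.iterations E
    set b := M.size + 1
    have hstr : ∀ {C t : ℕ}, t ≤ C * b → t ≤ C * (Q * b) := fun {C t} h =>
      h.trans (Nat.mul_le_mul_left _ (Nat.le_mul_of_pos_left _ (Nat.succ_pos _)))
    have hloop : ∀ {C t m : ℕ}, t ≤ C * ((m + 1) * b) → m + 1 ≤ Q → t ≤ C * (Q * b) :=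
      fun {C t m} h hm => h.trans (by gcongr)
    have h1 := hstr ht₁
    have h2 := hloop ht₂ (by simp only [Q, Inst.iterations]; omega)
    have h3 := hstr ht₃
    have h4 := hloop ht₄ (by simp only [Q, Inst.iterations]; omega)
    have h5 := hloop ht₅ (by simp only [Q, Inst.iterations]; omega)
    have h6 := hloop ht₆ (by have := hD.lt; simp only [Q, Inst.iterations]; omega)
    have h7 := hstr ht₇
    have hsq : ∀ x y : ℕ, (I.n - x) * (I.n + 1) + (I.n - y) ≤ (I.n + 1) ^ 2 := fun x y => by
      have : (I.n - x) * (I.n + 1) ≤ I.n * (I.n + 1) := Nat.mul_le_mul_right _ (Nat.sub_le _ _)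
      have : (I.n + 1) ^ 2 = I.n * (I.n + 1) + I.n + 1 := by ring
      omega
    have h8 := hloop ht₈ (by have := hsq ((startCode.run σ₆).reg 11) ((startCode.run σ₆).reg 12)
                             simp only [Q, Inst.iterations]; omega)
    have hc : 1 + (reg 0 : AExp).cost I.init ≤ 2 * (Q * b) := by
      have h9 : (reg 0 : AExp).cost I.init ≤ b := by
        have := Nat.size_le_size (hinit.1 0)
        simp only [AExp.cost, b]; omega
      have h10 : b ≤ Q * b := Nat.le_mul_of_pos_left _ (Nat.succ_pos _)
      have : 1 ≤ b := Nat.succ_pos _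
      omega
    calc _ ≤ 2 * (Q * b) + (C₁ * (Q * b) + (C₂ * (Q * b) + (C₃ * (Q * b) + (C₄ * (Q * b) +
          (C₅ * (Q * b) + (C₆ * (Q * b) + (C₇ * (Q * b) + C₈ * (Q * b)))))))) := by
          gcongr
      _ = _ := by ring

/-! ## Quasi-polynomial bounds -/

/-- Polylogarithmically bounded functions. -/
def PolyLog (f : ℕ → ℕ) : Prop := ∃ c k : ℕ, ∀ N, f N ≤ c * (Nat.log 2 N + 1) ^ k

theorem mul_pow_add_le (c d k m x : ℕ) (hx : 1 ≤ x) :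
    c * x ^ k + d * x ^ m ≤ (c + d) * x ^ (k + m) := by
  have h1 : x ^ k ≤ x ^ (k + m) := Nat.pow_le_pow_right hx (by omega)
  have h2 : x ^ m ≤ x ^ (k + m) := Nat.pow_le_pow_right hx (by omega)
  rw [add_mul]
  gcongr

theorem PolyLog.const (c : ℕ) : PolyLog fun _ => c := ⟨c, 0, fun N => by simp⟩

theorem PolyLog.log : PolyLog fun N => Nat.log 2 N + 1 := ⟨1, 1, fun N => by simp⟩

theorem PolyLog.mono {f g : ℕ → ℕ} (hg : PolyLog g) (h : ∀ N, f N ≤ g N) : PolyLog f :=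
  let ⟨c, k, hc⟩ := hg
  ⟨c, k, fun N => (h N).trans (hc N)⟩

theorem PolyLog.add {f g : ℕ → ℕ} (hf : PolyLog f) (hg : PolyLog g) :
    PolyLog fun N => f N + g N := by
  obtain ⟨c, k, hc⟩ := hf
  obtain ⟨d, m, hd⟩ := hg
  exact ⟨c + d, k + m, fun N => (add_le_add (hc N) (hd N)).trans
    (mul_pow_add_le _ _ _ _ _ (Nat.succ_pos _))⟩

theorem PolyLog.mul {f g : ℕ → ℕ} (hf : PolyLog f) (hg : PolyLog g) :
    PolyLog fun N => f N * g N := by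
  obtain ⟨c, k, hc⟩ := hf
  obtain ⟨d, m, hd⟩ := hg
  refine ⟨c * d, k + m, fun N => (Nat.mul_le_mul (hc N) (hd N)).trans (le_of_eq ?_)⟩
  ring

theorem QuasiPolynomial.mono {f g : ℕ → ℕ} (hg : QuasiPolynomial g) (h : ∀ N, f N ≤ g N) :
    QuasiPolynomial f :=
  let ⟨c, k, hc⟩ := hg
  ⟨c, k, fun N => (h N).trans (hc N)⟩

theorem PolyLog.two_pow {f : ℕ → ℕ} (hf : PolyLog f) : QuasiPolynomial fun N => 2 ^ f N :=
  let ⟨c, k, hc⟩ := hf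
  ⟨c, k, fun N => Nat.pow_le_pow_right (by norm_num) (hc N)⟩

theorem PolyLog.quasiPolynomial {f : ℕ → ℕ} (hf : PolyLog f) : QuasiPolynomial f :=
  hf.two_pow.mono fun _ => Nat.lt_two_pow_self.le

theorem QuasiPolynomial.mul {f g : ℕ → ℕ} (hf : QuasiPolynomial f) (hg : QuasiPolynomial g) :
    QuasiPolynomial fun N => f N * g N := by
  obtain ⟨c, k, hc⟩ := hf
  obtain ⟨d, m, hd⟩ := hg
  refine ⟨c + d, k + m, fun N => (Nat.mul_le_mul (hc N) (hd N)).trans ?_⟩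
  rw [← pow_add]
  exact Nat.pow_le_pow_right (by norm_num) (mul_pow_add_le _ _ _ _ _ (Nat.succ_pos _))

theorem QuasiPolynomial.const (c : ℕ) : QuasiPolynomial fun _ => c :=
  (PolyLog.const c).quasiPolynomial

theorem QuasiPolynomial.add {f g : ℕ → ℕ} (hf : QuasiPolynomial f) (hg : QuasiPolynomial g) :
    QuasiPolynomial fun N => f N + g N := by
  obtain ⟨c, k, hc⟩ := hf
  obtain ⟨d, m, hd⟩ := hg
  have hf' : QuasiPolynomial fun N => 2 ^ (c * (Nat.log 2 N + 1) ^ k) := ⟨c, k, fun N => le_rfl⟩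
  have hg' : QuasiPolynomial fun N => 2 ^ (d * (Nat.log 2 N + 1) ^ m) := ⟨d, m, fun N => le_rfl⟩
  refine ((QuasiPolynomial.const 2).mul (hf'.mul hg')).mono fun N => ?_
  have h1 := hc N
  have h2 := hd N
  have h3 : 1 ≤ 2 ^ (c * (Nat.log 2 N + 1) ^ k) := Nat.one_le_two_pow
  have h4 : 1 ≤ 2 ^ (d * (Nat.log 2 N + 1) ^ m) := Nat.one_le_two_pow
  nlinarith

theorem lt_two_pow_log_succ (N : ℕ) : N < 2 ^ (Nat.log 2 N + 1) :=
  Nat.lt_pow_succ_log_self (by norm_num) N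

theorem QuasiPolynomial.id : QuasiPolynomial fun N => N :=
  PolyLog.log.two_pow.mono fun N => (lt_two_pow_log_succ N).le

theorem PolyLog.succ_pow {f : ℕ → ℕ} (hf : PolyLog f) : QuasiPolynomial fun N => (N + 1) ^ f N := by
  refine (PolyLog.log.mul hf).two_pow.mono fun N => ?_
  rw [pow_mul]
  exact Nat.pow_le_pow_left (lt_two_pow_log_succ N) _

theorem polyLog_clog (c : ℕ) : PolyLog fun N => Nat.clog 2 (c * (N * N)) := by
  refine ((PolyLog.const c.size).add (PolyLog.log.add PolyLog.log)).mono fun N => ?_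
  rw [Nat.clog_le_iff_le_pow (by norm_num), pow_add, pow_add]
  have := lt_two_pow_log_succ N
  exact Nat.mul_le_mul (Nat.lt_size_self c).le (Nat.mul_le_mul this.le this.le)

theorem polyLog_precision (E : ℕ) {f : ℕ → ℕ} (hf : PolyLog f) :
    PolyLog fun N => precision E (f N) :=
  (PolyLog.const E).mul ((hf.mul (((PolyLog.const E).mul hf).add (PolyLog.const 1))).add
    (PolyLog.const 1))

theorem precision_mono (E : ℕ) : Monotone (precision E) := by
  intro a b h
  unfold precision
  gcongr

/-! ## The running time -/

/-- A bound on all numbers that occur. -/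
def Inst.maxValue (I : Inst) (E : ℕ) : ℕ :=
  2 ^ (I.classes E + 1) * (I.init.arr 0 0 + 1) +
    (I.n + 1) * I.codes E * (I.triples E + 1) + 2 ^ I.logSize E + I.prec E + I.classes E

theorem Inst.bound_maxValue (I : Inst) (E : ℕ) : I.Bound E (I.maxValue E) := by
  have hc := I.codes_pos E
  have hg : ∀ k ≤ I.classes E, grid (I.prec E) k ≤ 2 ^ (I.classes E + 1) := fun k hk =>
    (Nat.le_succ _).trans ((grid_le_two_pow _ k).trans
      (Nat.pow_le_pow_right (by norm_num) (by omega)))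
  have h1 : 1 ≤ 2 ^ (I.classes E + 1) := Nat.one_le_two_pow
  have hmax : ∀ x, x ≤ 2 ^ (I.classes E + 1) * (I.init.arr 0 0 + 1) ∨
      x ≤ (I.n + 1) * I.codes E * (I.triples E + 1) ∨ x ≤ 2 ^ I.logSize E ∨ x ≤ I.prec E ∨
      x ≤ I.classes E → x ≤ I.maxValue E := by
    intro x
    unfold Inst.maxValue
    generalize 2 ^ (I.classes E + 1) * (I.init.arr 0 0 + 1) = A
    generalize (I.n + 1) * I.codes E * (I.triples E + 1) = B
    generalize 2 ^ I.logSize E = G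
    omega
  have hprod : ∀ a b c : ℕ, a ≤ I.n + 1 → b ≤ I.codes E → c ≤ I.triples E + 1 →
      a * b * c ≤ I.maxValue E := fun a b c ha hb hc =>
    hmax _ (.inr (.inl (Nat.mul_le_mul (Nat.mul_le_mul ha hb) hc)))
  have hgrid : ∀ a b : ℕ, a ≤ 2 ^ (I.classes E + 1) → b ≤ I.init.arr 0 0 + 1 →
      a * b ≤ I.maxValue E := fun a b ha hb => hmax _ (.inl (Nat.mul_le_mul ha hb))
  refine ⟨fun j => ?_, ?_, ?_, ?_, ?_, fun k hk => ?_, fun k hk => ?_, ?_, ?_, ?_⟩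
  · have h2 := I.init_arr_antitone (Nat.zero_le j)
    simpa using hgrid 1 (I.init.arr 0 j) h1 (by omega)
  · simpa using hprod I.n 1 1 (by omega) hc (by omega)
  · exact hmax _ (by simp)
  · exact hmax _ (by simp)
  · exact hmax _ (by simp)
  · simpa using hgrid _ 1 (hg k hk) (by omega)
  · exact hgrid _ _ (hg k hk) (by omega)
  · simpa using hprod 1 (I.codes E) 1 (by omega) le_rfl (by omega)
  · simpa using hprod 1 1 (I.triples E) (by omega) hc (by omega)
  · exact hprod _ _ _ (by omega) le_rfl (by omega)

def logBound (E N : ℕ) : ℕ := Nat.clog 2 (16 * E * (N * N))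

def classBound (E N : ℕ) : ℕ := precision E (logBound E N) * logBound E N

def tripleBound (E N : ℕ) : ℕ := classBound E N * classBound E N * classBound E N

def iterationBound (E N : ℕ) : ℕ :=
  logBound E N + classBound E N + N * (N + 1) ^ classBound E N * tripleBound E N + (N + 1) ^ 2 + 1

/-- A bound on all numbers that occur, up to a factor of `2 ^ N` for the processing times. -/
def valueBound (E N : ℕ) : ℕ :=
  2 ^ (classBound E N + 1) + (N + 1) * (N + 1) ^ classBound E N * (tripleBound E N + 1) +
    2 ^ logBound E N + precision E (logBound E N) + classBound E N

def timeBound (E N : ℕ) : ℕ := iterationBound E N * (N + valueBound E N + 1)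

theorem quasiPolynomial_timeBound (E : ℕ) : QuasiPolynomial (timeBound E) := by
  have hL : PolyLog (logBound E) := polyLog_clog _
  have hF : PolyLog fun N => precision E (logBound E N) := polyLog_precision E hL
  have hK : PolyLog (classBound E) := hF.mul hL
  have hK3 : PolyLog (tripleBound E) := (hK.mul hK).mul hK
  have hN1 : QuasiPolynomial fun N => N + 1 := QuasiPolynomial.id.add (QuasiPolynomial.const 1)
  have hV : QuasiPolynomial (valueBound E) :=
    ((((hK.add (PolyLog.const 1)).two_pow.add ((hN1.mul hK.succ_pow).mul
      (hK3.add (PolyLog.const 1)).quasiPolynomial)).add hL.two_pow).add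
        hF.quasiPolynomial).add hK.quasiPolynomial
  exact ((((hL.add hK).quasiPolynomial.add ((QuasiPolynomial.id.mul hK.succ_pow).mul
    hK3.quasiPolynomial)).add (PolyLog.const 2).succ_pow).add (QuasiPolynomial.const 1)).mul
      ((QuasiPolynomial.id.add hV).add (QuasiPolynomial.const 1))

theorem Inst.n_le_size (I : Inst) : I.n ≤ I.size := by
  have : ∑ _i : Fin I.n, 1 ≤ ∑ i, (I.p i).size :=
    Finset.sum_le_sum fun i _ => Nat.size_pos.2 (I.pos i)
  simpa [Inst.size] using this

theorem Inst.init_arr_lt (I : Inst) : I.init.arr 0 0 + 1 ≤ 2 ^ I.size := by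
  by_cases hn : 0 < I.n
  · have h1 : I.init.arr 0 0 = I.p ⟨0, hn⟩ := I.init_arr_zero ⟨0, hn⟩
    rw [h1]
    refine (Nat.lt_size_self _).trans_le (Nat.pow_le_pow_right (by norm_num) ?_)
    exact Finset.single_le_sum (f := fun i => (I.p i).size) (fun _ _ => Nat.zero_le _)
      (Finset.mem_univ _)
  · simp [Inst.init, hn, Nat.one_le_two_pow]

theorem Inst.time_le (I : Inst) (E : ℕ) :
    I.iterations E * ((I.maxValue E).size + 1) ≤ timeBound E I.size := by
  have hn := I.n_le_size
  have hL : I.logSize E ≤ logBound E I.size := by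
    unfold Inst.logSize logBound
    exact Nat.clog_mono_right _ (by gcongr)
  have hF : I.prec E ≤ precision E (logBound E I.size) := precision_mono E hL
  have hK : I.classes E ≤ classBound E I.size := Nat.mul_le_mul hF hL
  have hS : I.codes E ≤ (I.size + 1) ^ classBound E I.size :=
    (Nat.pow_le_pow_left (by omega) _).trans (Nat.pow_le_pow_right (by omega) hK)
  have hK3 : I.triples E ≤ tripleBound E I.size :=
    Nat.mul_le_mul (Nat.mul_le_mul hK hK) hK
  have hn' : I.n - 1 ≤ I.size := by omega
  have hi : I.iterations E ≤ iterationBound E I.size := by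
    unfold Inst.iterations iterationBound Inst.steps
    gcongr
  have hp := I.init_arr_lt
  have h2 : 1 ≤ 2 ^ I.size := Nat.one_le_two_pow
  have hv : I.maxValue E ≤ 2 ^ I.size * valueBound E I.size := by
    have hA : 2 ^ (I.classes E + 1) * (I.init.arr 0 0 + 1) ≤
        2 ^ I.size * 2 ^ (classBound E I.size + 1) := by
      rw [mul_comm]
      gcongr
      norm_num
    have hB : (I.n + 1) * I.codes E * (I.triples E + 1) + 2 ^ I.logSize E + I.prec E +
        I.classes E ≤ (I.size + 1) * (I.size + 1) ^ classBound E I.size *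
          (tripleBound E I.size + 1) + 2 ^ logBound E I.size +
          precision E (logBound E I.size) + classBound E I.size := by
      gcongr
      norm_num
    have hC := hB.trans (Nat.le_mul_of_pos_left _ (Nat.lt_of_succ_le h2))
    unfold Inst.maxValue valueBound
    linarith
  -- The processing times enter the values only through a factor `2 ^ N`. Bounding the bit length of
  -- `valueBound` by the number itself is crude but still quasi-polynomial.
  have hs : (I.maxValue E).size ≤ I.size + valueBound E I.size := by
    rw [Nat.size_le, pow_add]
    exact hv.trans_lt (Nat.mul_lt_mul_of_pos_left Nat.lt_two_pow_self (by positivity))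
  unfold timeBound
  gcongr

/-! ## The approximation ratio -/

/-- The bound `M ≤ n * p 0` is what forces the class of the length below `classes`, via `12 * E * n²
< 16 * E * n²`. -/
theorem Inst.exists_length (I : Inst) {E : ℕ} (hn : 0 < I.n) (hE : 0 < E) {s : Fin I.n → ℝ}
    {M : ℝ} (hs : I.Feasible s) (hM : ∀ i, s i + I.p i ≤ M)
    (hM' : M ≤ I.n * I.init.arr 0 0) :
    ∃ D, I.Length E D ∧
      (grid (I.prec E) D : ℝ) * (I.init.arr 0 0 / (I.n * E)) ≤ (1 + 11 / E) * M := by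
  have hL : 16 * E * (I.n * I.n) ≤ 2 ^ I.logSize E := Nat.le_pow_clog (by norm_num) _
  have hL' : I.n * E ≤ 2 ^ I.logSize E := le_trans (by nlinarith [Nat.mul_pos hn hE]) hL
  obtain ⟨D, h1, h2, h3⟩ := I.exists_good hn hE hL' hs hM
  have hF : 0 < precision E (I.logSize E) := by unfold precision; positivity
  have hn' : (0 : ℝ) < I.n := by exact_mod_cast hn
  have hE' : (1 : ℝ) ≤ E := by exact_mod_cast hE
  have hp0 : (0 : ℝ) < I.init.arr 0 0 := by exact_mod_cast I.init_arr_pos hn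
  have hDK : D < I.classes E := by
    have h4 : (grid (I.prec E) D : ℝ) * (I.init.arr 0 0 / (I.n * E)) ≤
        12 * (I.n * I.init.arr 0 0) := by
      refine h3.trans ?_
      have h5 : 11 / (E : ℝ) ≤ 11 := div_le_self (by norm_num) hE'
      calc (1 + 11 / (E : ℝ)) * M ≤ (1 + 11 / E) * (I.n * I.init.arr 0 0) := by gcongr
        _ ≤ 12 * (I.n * I.init.arr 0 0) := by gcongr; linarith
    have h5 : (grid (I.prec E) D : ℝ) ≤ 12 * E * (I.n * I.n) := by
      rw [mul_div_assoc', div_le_iff₀ (by positivity)] at h4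
      refine le_of_mul_le_mul_right (h4.trans (le_of_eq ?_)) hp0
      ring
    have h6 : grid (I.prec E) D ≤ 12 * E * (I.n * I.n) := by exact_mod_cast h5
    have h7 : 2 ^ I.logSize E ≤ grid (I.prec E) (I.classes E) := two_pow_le_grid hF _
    refine (grid_strictMono (I.prec E)).lt_iff_lt.1 ?_
    have h8 : 0 < E * (I.n * I.n) := Nat.mul_pos hE (Nat.mul_pos hn hn)
    nlinarith
  refine ⟨D, ⟨hDK, h1, ?_⟩, h3⟩
  have := solvable_of_good (grid_strictMono _) (fun k => grid_pos _ k) (I.n - 1) {D} h2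
    (K := I.classes E) (n := I.n) (by simpa using hDK) (by simp; omega)
  simpa [code, Inst.Solv, Inst.prec] using this

theorem Inst.exists_serial (I : Inst) : ∃ s, I.Feasible s ∧
    ∀ i, s i + I.p i ≤ I.n * I.init.arr 0 0 := by
  have hp : ∀ i, (I.p i : ℝ) ≤ I.init.arr 0 0 := fun i => by
    rw [← I.init_arr_zero i]
    exact_mod_cast I.init_arr_antitone (Nat.zero_le _)
  refine ⟨fun i => (i : ℕ) * I.init.arr 0 0, ⟨fun i => by positivity, fun i j hij => ?_⟩,
    fun i => ?_⟩
  · have h1 : (1 : ℝ) ≤ |((i : ℕ) : ℝ) - ((j : ℕ) : ℝ)| := by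
      have : (1 : ℤ) ≤ |((i : ℕ) : ℤ) - ((j : ℕ) : ℤ)| :=
        Int.one_le_abs fun h => hij (Fin.ext (by omega))
      exact_mod_cast this
    rw [← sub_mul, abs_mul, Nat.abs_cast]
    exact ((min_le_left _ _).trans (hp i)).trans
      (le_mul_of_one_le_left (Nat.cast_nonneg _) h1)
  · have h1 : ((i : ℕ) : ℝ) + 1 ≤ I.n := by exact_mod_cast i.2
    have h2 : (0 : ℝ) ≤ I.init.arr 0 0 := Nat.cast_nonneg _
    nlinarith [hp i]

theorem Inst.le_makespan (I : Inst) (s : Fin I.n → ℝ) (i : Fin I.n) :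
    s i + I.p i ≤ I.makespan s :=
  le_ciSup (f := fun j => s j + (I.p j : ℝ)) (Set.finite_range _).bddAbove i

theorem exec_scheme_approx {E : ℕ} (hE : 0 < E) : ∃ C, ∀ I : Inst, 0 < I.n →
    ∃ τ t, Exec (scheme E) I.init τ t ∧ t ≤ C * timeBound E I.size ∧
      I.Feasible (I.output τ) ∧ I.makespan (I.output τ) ≤ (1 + 11 / E) * I.opt := by
  classical
  obtain ⟨C, hC⟩ := exec_scheme E
  refine ⟨C, fun I hn => ?_⟩
  obtain ⟨s₀, hs₀, hM₀⟩ := I.exists_serial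
  have hex : ∃ D, I.Length E D :=
    let ⟨D, hD, _⟩ := I.exists_length hn hE hs₀ hM₀ le_rfl
    ⟨D, hD⟩
  obtain ⟨τ, t, D', he, ht, hD', hτ, hz⟩ := hC I _ (Nat.find hex) hn (I.bound_maxValue E)
    (Nat.find_spec hex)
  obtain ⟨hfeas, hspan⟩ := hτ.result hn hE hz
  refine ⟨τ, t, he, ht.trans (Nat.mul_le_mul_left _ (I.time_le E)), hfeas, ?_⟩
  have hpos : (0 : ℝ) < 1 + 11 / E := by positivity
  have key : ∀ (s : Fin I.n → ℝ) (M : ℝ), I.Feasible s → (∀ i, s i + I.p i ≤ M) →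
      M ≤ I.n * I.init.arr 0 0 → I.makespan (I.output τ) ≤ (1 + 11 / E) * M := by
    intro s M hs hM hM'
    obtain ⟨D, hD, hb⟩ := I.exists_length hn hE hs hM hM'
    have h1 : D' ≤ D := hD'.trans (Nat.find_min' hex hD)
    have h2 : (grid (I.prec E) D' : ℝ) ≤ grid (I.prec E) D := by
      exact_mod_cast (grid_strictMono _).monotone h1
    have : Nonempty (Fin I.n) := ⟨⟨0, hn⟩⟩
    refine ciSup_le fun i => (hspan i).trans (le_trans ?_ hb)
    gcongr
  -- Comparing with every feasible schedule and passing to the infimum avoids showing that the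
  -- optimum is attained. Schedules longer than `n * p 0` are replaced by the serial one.
  rw [mul_comm, ← div_le_iff₀ hpos]
  refine I.isGLB_opt.2 ?_
  rintro _ ⟨s, hs, rfl⟩
  rw [div_le_iff₀ hpos, mul_comm]
  rcases le_total (I.makespan s) (I.n * I.init.arr 0 0) with h | h
  · exact key s _ hs (I.le_makespan s) h
  · exact (key s₀ _ hs₀ hM₀ le_rfl).trans (by gcongr)

end TriangleScheduling

theorem mainTheorem3 (ε : ℝ) (hε : 0 < ε) :
    ∃ (P : TriangleScheduling.Prog) (T : ℕ → ℕ), TriangleScheduling.QuasiPolynomial T ∧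
      ∀ I : TriangleScheduling.Inst, ∃ (τ : TriangleScheduling.State) (t : ℕ),
        TriangleScheduling.Exec P I.init τ t ∧ t ≤ T I.size ∧
        I.Feasible (I.output τ) ∧ I.makespan (I.output τ) ≤ (1 + ε) * I.opt := by
  open TriangleScheduling in
  obtain ⟨E, hE⟩ := exists_nat_gt (11 / ε)
  have hE0 : (0 : ℝ) < E := (div_pos (by norm_num) hε).trans hE
  have hEε : 11 / (E : ℝ) ≤ ε := by
    rw [div_lt_iff₀ hε] at hE
    rw [div_le_iff₀ hE0]
    linarith
  obtain ⟨C, hC⟩ := exec_scheme_approx (E := E) (by exact_mod_cast hE0)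
  -- The summand 3 is the exact running time on the empty instance: the test costs 2 and `skip`
  -- costs 1.
  refine ⟨scheme E, fun N => C * timeBound E N + 3, ((QuasiPolynomial.const C).mul
    (quasiPolynomial_timeBound E)).add (QuasiPolynomial.const 3), fun I => ?_⟩
  have hopt : 0 ≤ I.opt := I.isGLB_opt.2 fun _ ⟨s, hs, h⟩ => h ▸ I.makespan_nonneg hs
  rcases Nat.eq_zero_or_pos I.n with hn | hn
  · have : IsEmpty (Fin I.n) := by rw [hn]; infer_instance
    refine ⟨I.init, _, Exec.iteFalse (by simp [Inst.init, hn]) (Exec.skip _), ?_,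
      ⟨fun i => isEmptyElim i, fun i => isEmptyElim i⟩, ?_⟩
    · simp [AExp.cost, Inst.init, hn]
    · rw [Inst.makespan, Real.iSup_of_isEmpty]
      positivity
  · obtain ⟨τ, t, h1, h2, h3, h4⟩ := hC I hn
    refine ⟨τ, t, h1, h2.trans (Nat.le_add_right _ _), h3, h4.trans ?_⟩
    gcongr
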